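/- A closed convex curve is the boundary of a compact convex subset of $\mathbb{R}^2$ with nonempty interior; let $\mathcal{C}$ be the set of all such curves with the Hausdorff metric. For $C\in\mathcal{C}$, a tangent line to $C$ at $z\in C$ is a line through $z$ having $C$ in one of its two closed half-planes. Let $u,v\in\mathbb{R}^2$ and $z\in C$. We say that $u$ sees an image of $v$ via $z$ if $C$ has a unique tangent line $T(z)$ at $z$, both $u$ and $v$ lie in the open half-plane bounded by $T(z)$ whose closure contains $C$, and the normal line $N(z)$ (the line through $z$ orthogonal to $T(z)$) halves the angle $\angle uzv$. Theorem. There is a comeagre set of curves $C\in\mathcal{C}$ such that for every point $v\in\mathbb{R}^2\setminus C$ the set of those $u\in\mathbb{R}^2$ that see continuum many images of $v$, that is, for which $\{z\in C: u \text{ sees an image of } v \text{ via } z\}$ has the cardinality of the continuum, is comeagre in $\mathbb{R}^2$. -/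

import Mathlib

open scoped Cardinal EuclideanGeometry

/-- The Euclidean plane. -/
abbrev Plane : Type := EuclideanSpace ℝ (Fin 2)

/-- A closed convex curve: the boundary of a compact convex set with nonempty interior. -/
def IsConvexCurve (C : Set Plane) : Prop :=
  ∃ K : Set Plane, Convex ℝ K ∧ IsCompact K ∧ (interior K).Nonempty ∧ frontier K = C

/-- The space of closed convex curves. As a subtype of the nonempty compact subsets of the plane
it carries the Hausdorff metric. -/
abbrev ConvexCurve : Type :=
  {C : TopologicalSpace.NonemptyCompacts Plane // IsConvexCurve (C : Set Plane)}

/-- The set of points of a convex curve. -/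
def ConvexCurve.points (C : ConvexCurve) : Set Plane := (C.1 : Set Plane)

/-- `T` is a tangent line to `C` at `z`: a line through `z` such that `C` has no two points
strictly on opposite sides of it. -/
def IsTangentLine (C : Set Plane) (z : Plane) (T : AffineSubspace ℝ Plane) : Prop :=
  Module.finrank ℝ T.direction = 1 ∧ z ∈ T ∧ ∀ x ∈ C, ∀ y ∈ C, ¬ T.SOppSide x y

/-- The line through `z` orthogonal to the line `T`. -/
noncomputable def normalLine (T : AffineSubspace ℝ Plane) (z : Plane) : AffineSubspace ℝ Plane :=
  AffineSubspace.mk' z T.directionᗮ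

/-- The line `N` through `z` halves the angle `∠ u z v`: a point `p ≠ z` of `N` makes with `u` and
with `v` half of that angle. -/
def HalvesAngle (N : AffineSubspace ℝ Plane) (u z v : Plane) : Prop :=
  ∃ p ∈ N, p ≠ z ∧ ∠ u z p = ∠ u z v / 2 ∧ ∠ p z v = ∠ u z v / 2

/-- `u` sees an image of `v` via the point `z` of the curve `C`: the tangent line `T` to `C` at `z`
is unique, the points `u` and `v` are strictly on the same side of `T`, the curve `C` is on that
side (up to its points on `T`), and the normal line at `z` halves the angle `∠ u z v`. -/
def SeesImageVia (C : Set Plane) (u v z : Plane) : Prop :=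
  z ∈ C ∧ ∃ T : AffineSubspace ℝ Plane,
    IsTangentLine C z T ∧ (∀ T', IsTangentLine C z T' → T' = T) ∧
    T.SSameSide u v ∧ (∀ x ∈ C, T.WSameSide u x) ∧
    HalvesAngle (normalLine T z) u z v

namespace ConvexMirror

open Set Filter Topology Metric
open scoped RealInnerProductSpace Pointwise

/-! ### Plane geometry and unit normals -/

/-- Rotation of the plane by a right angle. -/
noncomputable def rot (x : Plane) : Plane := !₂[-x 1, x 0]

/-- The determinant of two plane vectors. -/
def cross (x y : Plane) : ℝ := x 0 * y 1 - x 1 * y 0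

lemma inner_eq_coord (x y : Plane) : ⟪x, y⟫ = x 0 * y 0 + x 1 * y 1 := by
  simp [PiLp.inner_apply, Fin.sum_univ_two]; ring

@[simp] lemma rot_zero_apply (x : Plane) : rot x 0 = -x 1 := by simp [rot]
@[simp] lemma rot_one_apply (x : Plane) : rot x 1 = x 0 := by simp [rot]

lemma inner_rot_left (x y : Plane) : ⟪rot x, y⟫ = cross x y := by
  simp [inner_eq_coord, cross]; ring

lemma norm_sq_coord (x : Plane) : ‖x‖ ^ 2 = x 0 ^ 2 + x 1 ^ 2 := by
  rw [← real_inner_self_eq_norm_sq, inner_eq_coord]; ring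

@[simp] lemma norm_rot (x : Plane) : ‖rot x‖ = ‖x‖ := by
  rw [← sq_eq_sq₀ (norm_nonneg _) (norm_nonneg _), norm_sq_coord, norm_sq_coord]
  simp; ring

lemma coord_sq_of_norm_eq_one {n : Plane} (hn : ‖n‖ = 1) : n 0 ^ 2 + n 1 ^ 2 = 1 := by
  rw [← norm_sq_coord, hn]; norm_num

/-- Expansion of a vector in the orthonormal frame `n`, `rot n`. -/
lemma frame_expansion {n : Plane} (hn : ‖n‖ = 1) (x : Plane) :
    x = ⟪n, x⟫ • n + cross n x • rot n := by
  have h := coord_sq_of_norm_eq_one hn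
  ext i
  fin_cases i
  · simp [inner_eq_coord, cross]; linear_combination (-x 0) * h
  · simp [inner_eq_coord, cross]; linear_combination (-x 1) * h

lemma inner_frame {n : Plane} (hn : ‖n‖ = 1) (a b c d : ℝ) :
    ⟪a • n + b • rot n, c • n + d • rot n⟫ = a * c + b * d := by
  have h := coord_sq_of_norm_eq_one hn
  simp [inner_eq_coord]; linear_combination (a * c + b * d) * h

lemma cross_frame {n : Plane} (hn : ‖n‖ = 1) (a b c d : ℝ) :
    cross (a • n + b • rot n) (c • n + d • rot n) = a * d - b * c := by
  have h := coord_sq_of_norm_eq_one hn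
  simp [cross]; linear_combination (a * d - b * c) * h

lemma norm_sq_frame {n : Plane} (hn : ‖n‖ = 1) (x : Plane) :
    ‖x‖ ^ 2 = ⟪n, x⟫ ^ 2 + cross n x ^ 2 := by
  have h := coord_sq_of_norm_eq_one hn
  rw [norm_sq_coord]; simp only [inner_eq_coord, cross]
  linear_combination (-(x 0 ^ 2 + x 1 ^ 2)) * h

lemma inner_mul_add_cross_mul {n : Plane} (hn : ‖n‖ = 1) (x y : Plane) :
    ⟪x, y⟫ = ⟪n, x⟫ * ⟪n, y⟫ + cross n x * cross n y := by
  have h := coord_sq_of_norm_eq_one hn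
  simp only [inner_eq_coord, cross]
  linear_combination (-(x 0 * y 0 + x 1 * y 1)) * h

lemma abs_cross_le (x y : Plane) : |cross x y| ≤ ‖x‖ * ‖y‖ := by
  rw [← inner_rot_left, ← norm_rot x]; exact abs_real_inner_le_norm _ _

@[simp] lemma cross_self (x : Plane) : cross x x = 0 := by simp [cross]; ring
lemma cross_add_right (x y z : Plane) : cross x (y + z) = cross x y + cross x z := by
  simp [cross]; ring
lemma cross_sub_right (x y z : Plane) : cross x (y - z) = cross x y - cross x z := by
  simp [cross]; ring
lemma cross_smul_right (a : ℝ) (x y : Plane) : cross x (a • y) = a * cross x y := by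
  simp [cross]; ring
lemma cross_sub_self_right (x y : Plane) : cross x (y - x) = cross x y := by
  simp [cross]; ring

@[fun_prop] lemma continuous_rot : Continuous rot := by
  have : rot = fun x : Plane => !₂[-x 1, x 0] := rfl
  rw [this]; fun_prop

@[fun_prop] lemma continuous_cross {X : Type*} [TopologicalSpace X] {f g : X → Plane}
    (hf : Continuous f) (hg : Continuous g) : Continuous fun t => cross (f t) (g t) := by
  unfold cross; fun_prop

/-- `n` is a unit outer normal vector of `K` at its point `z`. -/
structure IsUnitNormal (K : Set Plane) (z n : Plane) : Prop where
  mem : z ∈ K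
  norm_eq : ‖n‖ = 1
  inner_le : ∀ x ∈ K, ⟪n, x - z⟫ ≤ 0

lemma IsUnitNormal.inner_le' {K : Set Plane} {z n x : Plane} (h : IsUnitNormal K z n)
    (hx : x ∈ K) : ⟪n, x⟫ ≤ ⟪n, z⟫ := by
  have := h.inner_le x hx
  rw [inner_sub_right] at this; linarith

lemma not_mem_interior_of_inner_le {K : Set Plane} {z n : Plane} (hn : n ≠ 0)
    (h : ∀ x ∈ K, ⟪n, x - z⟫ ≤ 0) : z ∉ interior K := by
  intro hz
  have hc : Tendsto (fun s : ℝ => z + s • n) (𝓝[>] 0) (𝓝 z) := by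
    have : Continuous fun s : ℝ => z + s • n := by fun_prop
    simpa using (this.tendsto 0).mono_left nhdsWithin_le_nhds
  obtain ⟨s, hs, hs0⟩ := ((hc.eventually (mem_interior_iff_mem_nhds.1 hz)).and
    self_mem_nhdsWithin).exists
  have := h _ hs
  rw [add_sub_cancel_left, inner_smul_right, real_inner_self_eq_norm_sq] at this
  have h1 : 0 < ‖n‖ ^ 2 := by positivity
  have : 0 < s * ‖n‖ ^ 2 := mul_pos hs0 h1
  linarith

lemma IsUnitNormal.ne_zero {K : Set Plane} {z n : Plane} (h : IsUnitNormal K z n) : n ≠ 0 := by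
  rintro rfl; simpa using h.norm_eq

lemma mem_frontier_of_inner_le {K : Set Plane} {z n : Plane} (hz : z ∈ K) (hn : n ≠ 0)
    (h : ∀ x ∈ K, ⟪n, x - z⟫ ≤ 0) : z ∈ frontier K :=
  ⟨subset_closure hz, not_mem_interior_of_inner_le hn h⟩

/-- A linear functional on a compact set is maximal at a frontier point. -/
lemma exists_mem_frontier_inner_le {K : Set Plane} (hK : IsCompact K) (hne : K.Nonempty)
    {n : Plane} (hn : n ≠ 0) : ∃ y ∈ frontier K, y ∈ K ∧ ∀ x ∈ K, ⟪n, x⟫ ≤ ⟪n, y⟫ := by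
  obtain ⟨y, hy, hmax⟩ := hK.exists_isMaxOn hne (f := fun x => ⟪n, x⟫) (by fun_prop)
  refine ⟨y, mem_frontier_of_inner_le hy hn fun x hx => ?_, hy, fun x hx => hmax hx⟩
  have : ⟪n, x⟫ ≤ ⟪n, y⟫ := hmax hx
  rw [inner_sub_right]; linarith

lemma inner_le_of_forall_frontier {K : Set Plane} (hK : IsCompact K) {n : Plane} (hn : n ≠ 0)
    {c : ℝ} (h : ∀ x ∈ frontier K, ⟪n, x⟫ ≤ c) {x : Plane} (hx : x ∈ K) : ⟪n, x⟫ ≤ c := by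
  obtain ⟨y, hy, -, hmax⟩ := exists_mem_frontier_inner_le hK ⟨x, hx⟩ hn
  exact (hmax x hx).trans (h y hy)

lemma isUnitNormal_frontier_iff {K : Set Plane} (hK : IsCompact K) {z n : Plane} :
    IsUnitNormal (frontier K) z n ↔ IsUnitNormal K z n := by
  have hsub : frontier K ⊆ K := hK.isClosed.frontier_subset
  constructor
  · intro h
    refine ⟨hsub h.mem, h.norm_eq, fun x hx => ?_⟩
    have := inner_le_of_forall_frontier hK h.ne_zero (fun y hy => h.inner_le' hy) hx
    rw [inner_sub_right]; linarith
  · intro h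
    exact ⟨mem_frontier_of_inner_le h.mem h.ne_zero h.inner_le, h.norm_eq,
      fun x hx => h.inner_le x (hsub hx)⟩

/-- Nearest points in a compact convex set depend continuously on the point. -/
lemma exists_continuous_nearest {K : Set Plane} (hK : IsCompact K) (hc : Convex ℝ K)
    (hne : K.Nonempty) : ∃ P : Plane → Plane, Continuous P ∧
      ∀ w, P w ∈ K ∧ ∀ x ∈ K, ⟪w - P w, x - P w⟫ ≤ 0 := by
  have h : ∀ w : Plane, ∃ p ∈ K, ∀ x ∈ K, ⟪w - p, x - p⟫ ≤ 0 := by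
    intro w
    obtain ⟨p, hp, hpw⟩ := exists_norm_eq_iInf_of_complete_convex hne hK.isComplete hc w
    exact ⟨p, hp, (norm_eq_iInf_iff_real_inner_le_zero hc hp).1 hpw⟩
  choose P hP hP' using h
  refine ⟨P, ?_, fun w => ⟨hP w, hP' w⟩⟩
  have : LipschitzWith 1 P := by
    refine LipschitzWith.of_dist_le_mul fun v w => ?_
    rw [NNReal.coe_one, one_mul, dist_eq_norm, dist_eq_norm]
    have h1 := hP' v (P w) (hP w)
    have h2 := hP' w (P v) (hP v)
    have h3 : ‖P v - P w‖ ^ 2 ≤ ⟪v - w, P v - P w⟫ := by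
      rw [← real_inner_self_eq_norm_sq]
      simp only [inner_sub_left, inner_sub_right] at *
      linarith
    have h4 := real_inner_le_norm (v - w) (P v - P w)
    by_contra! hlt
    have h5 : 0 < ‖P v - P w‖ := (norm_nonneg _).trans_lt hlt
    nlinarith
  exact this.continuous

lemma nearest_unique {K : Set Plane} {w p q : Plane} (hp : p ∈ K) (hq : q ∈ K)
    (h1 : ∀ x ∈ K, ⟪w - p, x - p⟫ ≤ 0) (h2 : ∀ x ∈ K, ⟪w - q, x - q⟫ ≤ 0) : p = q := by
  have h1 := h1 q hq
  have h2 := h2 p hp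
  have h3 : ‖p - q‖ ^ 2 ≤ 0 := by
    rw [← real_inner_self_eq_norm_sq]
    simp only [inner_sub_left, inner_sub_right] at *
    linarith
  rw [← sub_eq_zero, ← norm_eq_zero]
  exact pow_eq_zero_iff two_ne_zero |>.1 (le_antisymm h3 (sq_nonneg _))

lemma norm_inv_norm_smul_sub_le {g n : Plane} (hn : ‖n‖ = 1) :
    ‖‖g‖⁻¹ • g - n‖ ≤ 2 * ‖g - n‖ := by
  rcases eq_or_ne g 0 with rfl | hg
  · simp [hn]
  have hg' : ‖g‖ ≠ 0 := norm_ne_zero_iff.2 hg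
  have h1 : ‖‖g‖⁻¹ • g - g‖ = |1 - ‖g‖| := by
    have : ‖g‖⁻¹ • g - g = (‖g‖⁻¹ * (1 - ‖g‖)) • g := by
      rw [mul_sub, inv_mul_cancel₀ hg', sub_smul, mul_one, one_smul]
    rw [this, norm_smul, norm_mul, norm_inv, norm_norm, Real.norm_eq_abs]
    field_simp
  have h2 : |1 - ‖g‖| ≤ ‖g - n‖ := by
    rw [← hn, norm_sub_rev]; exact abs_norm_sub_norm_le n g
  calc _ ≤ ‖‖g‖⁻¹ • g - g‖ + ‖g - n‖ := norm_sub_le_norm_sub_add_norm_sub _ _ _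
    _ ≤ _ := by linarith

lemma norm_inv_norm_smul {g : Plane} (hg : g ≠ 0) : ‖‖g‖⁻¹ • g‖ = 1 := by
  rw [norm_smul, norm_inv, norm_norm, inv_mul_cancel₀ (norm_ne_zero_iff.2 hg)]

/-- Unit normals persist, approximately, under a perturbation of the convex set. -/
lemma IsUnitNormal.exists_near {K : Set Plane} {z n : Plane} (hn : ‖n‖ = 1)
    (hK : IsCompact K) (hc : Convex ℝ K) {ε : ℝ} (hε : 0 < ε) (hε1 : ε < 1)
    (hy : ∃ y ∈ K, dist z y ≤ ε) (hle : ∀ x ∈ K, ⟪n, x - z⟫ ≤ ε) :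
    ∃ z' n', IsUnitNormal K z' n' ∧ dist z' z ≤ √(5 * ε) ∧ dist n' n ≤ 2 * √(5 * ε) := by
  obtain ⟨y, hyK, hyz⟩ := hy
  obtain ⟨P, -, hP⟩ := exists_continuous_nearest hK hc ⟨y, hyK⟩
  set w := z + n with hw
  set p := P w
  obtain ⟨hpK, hp⟩ := hP w
  set g := w - p with hg
  have h1 : 1 - ε ≤ ⟪n, g⟫ := by
    have := hle p hpK
    have e : ⟪n, n⟫ = 1 := by rw [real_inner_self_eq_norm_sq, hn]; norm_num
    rw [hg, hw, show z + n - p = n - (p - z) by abel, inner_sub_right, e]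
    linarith
  have h2 : ‖g‖ ≤ 1 + ε := by
    have h3 : ‖g‖ ^ 2 ≤ ⟪g, w - y⟫ := by
      have := hp y hyK
      rw [← real_inner_self_eq_norm_sq]
      have e : w - y = g - (y - p) := by rw [hg]; abel
      rw [e, inner_sub_right g g]
      linarith
    have h4 : ‖w - y‖ ≤ 1 + ε := by
      calc ‖w - y‖ = ‖n + (z - y)‖ := by rw [hw]; congr 1; abel
        _ ≤ ‖n‖ + ‖z - y‖ := norm_add_le _ _
        _ ≤ 1 + ε := by rw [hn, ← dist_eq_norm]; linarith
    have h5 := real_inner_le_norm g (w - y)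
    by_contra! hlt
    have := norm_nonneg g
    nlinarith
  have h3 : ‖g - n‖ ≤ √(5 * ε) := by
    apply Real.le_sqrt_of_sq_le
    rw [norm_sub_sq_real, hn, real_inner_comm]
    have : ‖g‖ ^ 2 ≤ (1 + ε) ^ 2 := by gcongr
    nlinarith
  have hg0 : g ≠ 0 := by
    intro h; rw [h, inner_zero_right] at h1; linarith
  refine ⟨p, ‖g‖⁻¹ • g, ⟨hpK, norm_inv_norm_smul hg0, fun x hx => ?_⟩, ?_, ?_⟩
  · rw [real_inner_smul_left]
    exact mul_nonpos_of_nonneg_of_nonpos (by positivity) (hp x hx)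
  · rw [dist_eq_norm, norm_sub_rev, show z - p = g - n by rw [hg, hw]; abel]; exact h3
  · rw [dist_eq_norm]
    exact (norm_inv_norm_smul_sub_le hn).trans (by linarith)

/-! ### Typical convex curves -/

lemma eventually_residual_mem_of_mem_closure {X : Type*} [TopologicalSpace X] {A : Set X}
    (hA : IsOpen A) : ∀ᶠ x in residual X, x ∈ closure A → x ∈ A := by
  have hd : Dense (A ∪ (closure A)ᶜ) := by
    rw [dense_iff_closure_eq, closure_union, eq_univ_iff_forall]
    intro x
    by_cases hx : x ∈ closure A
    · exact Or.inl hx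
    · exact Or.inr (subset_closure hx)
  filter_upwards [residual_of_dense_open (hA.union isClosed_closure.isOpen_compl) hd] with x hx h
  exact hx.resolve_right fun h' => h' h

lemma exists_frontier_mem_segment {K : Set Plane} {a b : Plane} (hK : IsClosed K)
    (ha : a ∈ K) (hb : b ∉ K) : ∃ c ∈ frontier K, c ∈ segment ℝ a b := by
  by_contra! h
  have hsub : segment ℝ a b ⊆ interior K ∪ Kᶜ := by
    intro x hx
    by_cases hxK : x ∈ K
    · left
      by_contra hxi
      exact h x ⟨subset_closure hxK, hxi⟩ hx
    · exact Or.inr hxK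
  have ha' : a ∈ interior K := (hsub (left_mem_segment ℝ a b)).resolve_right fun h => h ha
  have := (convex_segment a b).isPreconnected.subset_left_of_subset_union isOpen_interior
    hK.isOpen_compl (disjoint_left.2 fun x hx hx' => hx' (interior_subset hx)) hsub
    ⟨a, left_mem_segment ℝ a b, ha'⟩
  exact hb (interior_subset (this (right_mem_segment ℝ a b)))

lemma dist_left_le_of_mem_segment {a b c : Plane} (hc : c ∈ segment ℝ a b) :
    dist a c ≤ dist a b := by
  have := (mem_segment_iff_wbtw.1 hc).dist_add_dist
  have := dist_nonneg (x := c) (y := b)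
  linarith

lemma exists_body (C : ConvexCurve) : ∃ K : Set Plane, Convex ℝ K ∧ IsCompact K ∧
    (interior K).Nonempty ∧ frontier K = C.points := C.2

lemma dist_curve (C D : ConvexCurve) : dist C D = hausdorffDist C.points D.points := rfl

lemma exists_mem_points_dist_lt {C D : ConvexCurve} {x : Plane} {r : ℝ} (hx : x ∈ C.points)
    (h : dist C D < r) : ∃ y ∈ D.points, dist x y < r :=
  exists_dist_lt_of_hausdorffDist_lt hx h (hausdorffEDist_ne_top_of_nonempty_of_bounded
    C.1.nonempty D.1.nonempty C.1.isCompact.isBounded D.1.isCompact.isBounded)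

lemma IsUnitNormal.exists_near_curve {C D : ConvexCurve} {z n : Plane}
    (h : IsUnitNormal C.points z n) {ε : ℝ} (hε : ε < 1) (hd : dist D C < ε) :
    ∃ z' n', IsUnitNormal D.points z' n' ∧ dist z' z ≤ √(5 * ε) ∧ dist n' n ≤ 2 * √(5 * ε) := by
  obtain ⟨K, hKc, hK, hKi, hKf⟩ := exists_body D
  have hsub : D.points ⊆ K := hKf ▸ hK.isClosed.frontier_subset
  obtain ⟨y, hy, hyz⟩ := exists_mem_points_dist_lt h.mem (dist_comm D C ▸ hd)
  have hle : ∀ x ∈ K, ⟪n, x⟫ ≤ ⟪n, z⟫ + ε := by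
    intro x hx
    refine inner_le_of_forall_frontier hK h.ne_zero (fun x hx => ?_) hx
    obtain ⟨y, hy, hxy⟩ := exists_mem_points_dist_lt (hKf ▸ hx) hd
    have h1 := h.inner_le' hy
    have h2 := real_inner_le_norm n (x - y)
    rw [h.norm_eq, one_mul, ← dist_eq_norm, inner_sub_right] at h2
    linarith
  obtain ⟨z', n', hn', h1, h2⟩ := IsUnitNormal.exists_near (z := z) h.norm_eq hK hKc
    (dist_nonneg.trans_lt hd) hε ⟨y, hsub hy, hyz.le⟩ fun x hx => by
      rw [inner_sub_right]; linarith [hle x hx]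
  exact ⟨z', n', hKf ▸ (isUnitNormal_frontier_iff hK).2 hn', h1, h2⟩

lemma isOpen_setOf_exists_normals {V : Set ((Plane × Plane) × (Plane × Plane))}
    (hV : IsOpen V) : IsOpen {C : ConvexCurve | ∃ a b : Plane × Plane,
      IsUnitNormal C.points a.1 a.2 ∧ IsUnitNormal C.points b.1 b.2 ∧ (a, b) ∈ V} := by
  rw [Metric.isOpen_iff]
  rintro C ⟨a, b, ha, hb, hab⟩
  obtain ⟨r, hr, hrV⟩ := Metric.isOpen_iff.1 hV _ hab
  have hlim : Tendsto (fun ε : ℝ => 2 * √(5 * ε)) (𝓝[>] 0) (𝓝 0) := by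
    have : Continuous fun ε : ℝ => 2 * √(5 * ε) := by fun_prop
    simpa using (this.tendsto 0).mono_left nhdsWithin_le_nhds
  obtain ⟨ε, ⟨hεr, hε1⟩, hε0⟩ := (((hlim.eventually (gt_mem_nhds hr)).and
    ((gt_mem_nhds zero_lt_one).filter_mono nhdsWithin_le_nhds)).and self_mem_nhdsWithin).exists
  refine ⟨ε, hε0, fun D hD => ?_⟩
  obtain ⟨z, n, h, hz, hn⟩ := ha.exists_near_curve hε1 hD
  obtain ⟨z', n', h', hz', hn'⟩ := hb.exists_near_curve hε1 hD
  have h0 := Real.sqrt_nonneg (5 * ε)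
  refine ⟨(z, n), (z', n'), h, h', hrV ?_⟩
  simp only [mem_ball, Prod.dist_eq, max_lt_iff]
  exact ⟨⟨by linarith, by linarith⟩, by linarith, by linarith⟩

lemma exists_mem_frontier_near_of_subset {K K' : Set Plane} (hK : IsCompact K)
    (hKc : Convex ℝ K) (hK' : IsCompact K') (hsub : K ⊆ K') {δ : ℝ} (hδ : 0 < δ)
    (hnear : ∀ x ∈ K', ∃ y ∈ K, dist x y ≤ δ) {z : Plane} (hz : z ∈ frontier K) :
    ∃ y ∈ frontier K', dist z y ≤ 4 * δ := by
  have hzK := hK.isClosed.frontier_subset hz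
  obtain ⟨P, -, hP⟩ := exists_continuous_nearest hK hKc ⟨z, hzK⟩
  have hz' : z ∈ closure Kᶜ := by
    rw [closure_compl]; exact hz.2
  obtain ⟨x, hxK, hxz⟩ := Metric.mem_closure_iff.1 hz' δ hδ
  obtain ⟨hpK, hp⟩ := hP x
  set p := P x
  set g := x - p with hg
  have hg0 : g ≠ 0 := by
    intro h; exact hxK (by rwa [sub_eq_zero.1 h])
  have hgn : 0 < ‖g‖ := norm_pos_iff.2 hg0
  have hgz : ‖g‖ ≤ ‖x - z‖ := by
    have h1 : ‖g‖ ^ 2 ≤ ⟪g, x - z⟫ := by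
      have := hp z hzK
      rw [← real_inner_self_eq_norm_sq]
      rw [show x - z = g - (z - p) by rw [hg]; abel, inner_sub_right g g]
      linarith
    have h2 := real_inner_le_norm g (x - z)
    nlinarith
  rw [dist_eq_norm, norm_sub_rev] at hxz
  have hpz : dist z p ≤ 2 * δ := by
    rw [dist_eq_norm, show z - p = g - (x - z) by rw [hg]; abel]
    exact (norm_sub_le _ _).trans (by linarith)
  set n := ‖g‖⁻¹ • g with hn
  have hn1 : ‖n‖ = 1 := norm_inv_norm_smul hg0
  have hout : p + (2 * δ) • n ∉ K' := by
    intro hmem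
    obtain ⟨y, hy, hyd⟩ := hnear _ hmem
    have h1 : ⟪n, y - p⟫ ≤ 0 := by
      rw [hn, real_inner_smul_left]
      exact mul_nonpos_of_nonneg_of_nonpos (by positivity) (hp y hy)
    have h2 := real_inner_le_norm n (p + (2 * δ) • n - y)
    rw [hn1, one_mul, ← dist_eq_norm,
      show p + (2 * δ) • n - y = (2 * δ) • n - (y - p) by abel, inner_sub_right, inner_smul_right,
      real_inner_self_eq_norm_sq, hn1] at h2
    linarith
  obtain ⟨y, hy, hys⟩ := exists_frontier_mem_segment hK'.isClosed (hsub hpK) hout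
  refine ⟨y, hy, ?_⟩
  have h1 := dist_left_le_of_mem_segment hys
  have h2 : dist p (p + (2 * δ) • n) = 2 * δ := by
    rw [dist_self_add_right, norm_smul, hn1, Real.norm_eq_abs, abs_of_pos (by linarith), mul_one]
  linarith [dist_triangle z p y]

/-- A convex body slightly larger than a given one has a curve close to the given one. -/
lemma exists_curve_of_subset {C : ConvexCurve} {K K' : Set Plane} (hK : IsCompact K)
    (hKc : Convex ℝ K) (hKi : (interior K).Nonempty) (hKf : frontier K = C.points)
    (hK' : IsCompact K') (hKc' : Convex ℝ K') (hsub : K ⊆ K') {δ : ℝ} (hδ : 0 < δ)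
    (hnear : ∀ x ∈ K', ∃ y ∈ K, dist x y ≤ δ) :
    ∃ D : ConvexCurve, D.points = frontier K' ∧ dist D C ≤ 4 * δ := by
  have hcomp : IsCompact (frontier K') :=
    hK'.of_isClosed_subset isClosed_frontier hK'.isClosed.frontier_subset
  obtain ⟨c, hc⟩ : (frontier K).Nonempty := hKf ▸ C.1.nonempty
  obtain ⟨c', hc', -⟩ := exists_mem_frontier_near_of_subset hK hKc hK' hsub hδ hnear hc
  refine ⟨⟨⟨⟨frontier K', hcomp⟩, ⟨c', hc'⟩⟩, K', hKc', hK', hKi.mono (interior_mono hsub), rfl⟩,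
    rfl, ?_⟩
  rw [dist_curve, ← hKf]
  refine hausdorffDist_le_of_mem_dist (by positivity) ?_
    fun z hz => exists_mem_frontier_near_of_subset hK hKc hK' hsub hδ hnear hz
  intro x hx
  have hx : x ∈ frontier K' := hx
  by_cases hxK : x ∈ K
  · exact ⟨x, ⟨subset_closure hxK, fun h => hx.2 (interior_mono hsub h)⟩, by simp; positivity⟩
  · obtain ⟨y, hy, hxy⟩ := hnear x (hK'.isClosed.frontier_subset hx)
    obtain ⟨c, hc, hcs⟩ := exists_frontier_mem_segment hK.isClosed hy hxK
    rw [segment_symm] at hcs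
    exact ⟨c, hc, (dist_left_le_of_mem_segment hcs).trans (by linarith)⟩

lemma IsUnitNormal.of_points {C : ConvexCurve} {K : Set Plane} (hK : IsCompact K)
    (hKf : frontier K = C.points) {z n : Plane} (h : IsUnitNormal C.points z n) :
    IsUnitNormal K z n := (isUnitNormal_frontier_iff hK).1 (hKf ▸ h)

/-- Thickening a body by a segment makes a flat piece. -/
lemma mem_closure_flat {C : ConvexCurve} {z n : Plane} (hn : IsUnitNormal C.points z n)
    {B : Set (Plane × Plane)} (hB : IsOpen B) (hzB : (z, n) ∈ B) (M : ℝ) :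
    C ∈ closure {D : ConvexCurve | ∃ a b : Plane × Plane, IsUnitNormal D.points a.1 a.2 ∧
      IsUnitNormal D.points b.1 b.2 ∧ (a ∈ B ∧ b ∈ B ∧ M * dist a.2 b.2 < dist a.1 b.1)} := by
  obtain ⟨K, hKc, hK, hKi, hKf⟩ := exists_body C
  have hnK := hn.of_points hK hKf
  rw [Metric.mem_closure_iff]
  intro ε hε
  obtain ⟨r, hr, hrB⟩ := Metric.isOpen_iff.1 hB _ hzB
  set δ := min (r / 2) (ε / 8) with hδ
  have hδ0 : 0 < δ := by positivity
  have hδr : δ < r := (min_le_left _ _).trans_lt (by linarith)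
  have hδε : δ ≤ ε / 8 := min_le_right _ _
  have hrn : ‖rot n‖ = 1 := by rw [norm_rot, hn.norm_eq]
  have hnr : ⟪n, rot n⟫ = 0 := by rw [real_inner_comm, inner_rot_left, cross_self]
  set S : Set Plane := (fun s : ℝ => s • rot n) '' Icc (-δ) δ with hS
  have hSc : Convex ℝ S := by
    have := (convex_Icc (-δ) δ).linear_image (LinearMap.toSpanSingleton ℝ Plane (rot n))
    exact this
  have hSk : IsCompact S := isCompact_Icc.image (by fun_prop)
  have hnormal : ∀ s ∈ Icc (-δ) δ, IsUnitNormal (K + S) (z + s • rot n) n := by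
    intro s hs
    refine ⟨add_mem_add hnK.mem ⟨s, hs, rfl⟩, hn.norm_eq, ?_⟩
    rintro _ ⟨x, hx, _, ⟨t, ht, rfl⟩, rfl⟩
    have := hnK.inner_le x hx
    rw [show x + t • rot n - (z + s • rot n) = (x - z) + (t - s) • rot n by module,
      inner_add_right, inner_smul_right, hnr]
    linarith
  obtain ⟨D, hD, hDC⟩ := exists_curve_of_subset hK hKc hKi hKf (hK.add hSk) (hKc.add hSc)
    (fun x hx => ⟨x, hx, 0, ⟨0, ⟨by linarith, hδ0.le⟩, by simp⟩, by simp⟩) hδ0 (by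
      rintro _ ⟨x, hx, _, ⟨t, ht, rfl⟩, rfl⟩
      refine ⟨x, hx, ?_⟩
      simp only [dist_self_add_left, norm_smul, hrn, mul_one, Real.norm_eq_abs]
      exact abs_le.2 ht)
  have hmem : ∀ s ∈ Icc (-δ) δ, (z + s • rot n, n) ∈ B := by
    intro s hs
    apply hrB
    simp only [mem_ball, Prod.dist_eq, dist_self_add_left, norm_smul, hrn, mul_one,
      Real.norm_eq_abs, dist_self, max_lt_iff]
    exact ⟨(abs_le.2 hs).trans_lt hδr, hr⟩
  refine ⟨D, ⟨(z + δ • rot n, n), (z + (0 : ℝ) • rot n, n), ?_, ?_, hmem _ ?_, hmem _ ?_, ?_⟩, ?_⟩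
  · rw [hD, isUnitNormal_frontier_iff (hK.add hSk)]
    exact hnormal _ ⟨by linarith, le_rfl⟩
  · rw [hD, isUnitNormal_frontier_iff (hK.add hSk)]
    exact hnormal _ ⟨by linarith, hδ0.le⟩
  · exact ⟨by linarith, le_rfl⟩
  · exact ⟨by linarith, hδ0.le⟩
  · simp [norm_smul, hrn, hδ0.ne']
  · rw [dist_comm]; linarith

/-- Adding a point to a body makes a corner. -/
lemma mem_closure_corner {C : ConvexCurve} {z n : Plane} (hn : IsUnitNormal C.points z n)
    {B : Set (Plane × Plane)} (hB : IsOpen B) (hzB : (z, n) ∈ B) (M : ℝ) :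
    C ∈ closure {D : ConvexCurve | ∃ a b : Plane × Plane, IsUnitNormal D.points a.1 a.2 ∧
      IsUnitNormal D.points b.1 b.2 ∧ (a ∈ B ∧ b ∈ B ∧ M * dist a.1 b.1 < dist a.2 b.2)} := by
  obtain ⟨K, hKc, hK, hKi, hKf⟩ := exists_body C
  have hnK := hn.of_points hK hKf
  rw [Metric.mem_closure_iff]
  intro ε hε
  obtain ⟨r, hr, hrB⟩ := Metric.isOpen_iff.1 hB _ hzB
  obtain ⟨R, hR⟩ := hK.isBounded.subset_closedBall z
  set R' := max R 1 with hR'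
  have hR1 : 1 ≤ R' := le_max_right _ _
  set δ := min (min (r / 4) (ε / 8)) 1 with hδ
  have hδ0 : 0 < δ := by positivity
  have hδr : δ ≤ r / 4 := (min_le_left _ _).trans (min_le_left _ _)
  have hδε : δ ≤ ε / 8 := (min_le_left _ _).trans (min_le_right _ _)
  have hn1 := hn.norm_eq
  have hrn : ‖rot n‖ = 1 := by rw [norm_rot, hn1]
  have hnn : ⟪n, n⟫ = 1 := by rw [real_inner_self_eq_norm_sq, hn1]; norm_num
  have hnr : ⟪rot n, n⟫ = 0 := by rw [inner_rot_left, cross_self]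
  set p := z + δ • n with hp
  set K' := closure (convexHull ℝ (insert p K)) with hK'
  have hpK' : p ∈ K' := subset_closure (subset_convexHull ℝ _ (mem_insert _ _))
  have hmin : ∀ T : Set Plane, IsClosed T → Convex ℝ T → p ∈ T → K ⊆ T → K' ⊆ T :=
    fun T hT hTc hpT hKT => closure_minimal (convexHull_min (insert_subset hpT hKT) hTc) hT
  have hKk' : IsCompact K' := by
    apply Metric.isCompact_of_isClosed_isBounded isClosed_closure
    exact (isBounded_convexHull.2 (hK.isBounded.insert p)).closure
  have hpz : dist p z = δ := by
    rw [hp, dist_self_add_left, norm_smul, hn1, mul_one, Real.norm_eq_abs, abs_of_pos hδ0]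
  have hthick : K' ⊆ cthickening δ K := by
    refine hmin _ isClosed_cthickening (hKc.cthickening δ) ?_ (self_subset_cthickening K)
    exact mem_cthickening_of_dist_le _ z _ _ hnK.mem hpz.le
  set η := δ / R' with hη
  have hη0 : 0 < η := by positivity
  have hηδ : η ≤ δ := div_le_self hδ0.le hR1
  have hnormal : ∀ s ∈ Icc 0 η, IsUnitNormal K' p (‖n + s • rot n‖⁻¹ • (n + s • rot n)) := by
    intro s hs
    have hinn : ⟪n + s • rot n, n⟫ = 1 := by
      rw [inner_add_left, real_inner_smul_left, hnn, hnr]; ring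
    have hne : n + s • rot n ≠ 0 := by
      intro h; rw [h, inner_zero_left] at hinn; norm_num at hinn
    refine ⟨hpK', norm_inv_norm_smul hne, ?_⟩
    have hclosed : IsClosed {x : Plane | ⟪n + s • rot n, x⟫ ≤ ⟪n + s • rot n, p⟫} :=
      isClosed_le (by fun_prop) continuous_const
    have hconv : Convex ℝ {x : Plane | ⟪n + s • rot n, x⟫ ≤ ⟪n + s • rot n, p⟫} :=
      convex_halfSpace_le (innerₛₗ ℝ (n + s • rot n)).isLinear _
    intro x hx
    rw [real_inner_smul_left]
    refine mul_nonpos_of_nonneg_of_nonpos (by positivity) ?_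
    rw [inner_sub_right, sub_nonpos]
    refine hmin _ hclosed hconv (by simp) (fun y hy => ?_) hx
    have h1 := hnK.inner_le y hy
    have h2 : ⟪rot n, y - z⟫ ≤ R' := by
      refine (real_inner_le_norm _ _).trans ?_
      rw [hrn, one_mul, ← dist_eq_norm]
      exact (hR hy).trans (le_max_left _ _)
    have h3 : s * ⟪rot n, y - z⟫ ≤ δ := by
      calc s * ⟪rot n, y - z⟫ ≤ s * R' := by gcongr; exact hs.1
        _ ≤ η * R' := by gcongr; exact hs.2
        _ = δ := by rw [hη]; field_simp
    rw [mem_ofPred_eq, ← sub_nonpos, ← inner_sub_right,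
      show y - p = (y - z) - δ • n by rw [hp]; abel, inner_sub_right, inner_smul_right, hinn,
      inner_add_left, real_inner_smul_left]
    linarith
  have hdist : ∀ s ∈ Icc 0 η, dist (‖n + s • rot n‖⁻¹ • (n + s • rot n)) n ≤ 2 * s := by
    intro s hs
    rw [dist_eq_norm]
    refine (norm_inv_norm_smul_sub_le hn1).trans ?_
    rw [add_sub_cancel_left, norm_smul, hrn, mul_one, Real.norm_eq_abs, abs_of_nonneg hs.1]
  have hmem : ∀ s ∈ Icc 0 η, (p, ‖n + s • rot n‖⁻¹ • (n + s • rot n)) ∈ B := by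
    intro s hs
    apply hrB
    simp only [mem_ball, Prod.dist_eq, max_lt_iff]
    exact ⟨by rw [hpz]; linarith, (hdist s hs).trans_lt (by linarith [hs.2])⟩
  obtain ⟨D, hD, hDC⟩ := exists_curve_of_subset hK hKc hKi hKf hKk' (convex_convexHull ℝ _).closure
    (fun x hx => subset_closure (subset_convexHull ℝ _ (mem_insert_of_mem _ hx))) hδ0 (by
      intro x hx
      have := hthick hx
      rw [hK.cthickening_eq_biUnion_closedBall hδ0.le] at this
      simpa using this)
  have h0 : (0 : ℝ) ∈ Icc 0 η := ⟨le_rfl, hη0.le⟩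
  have h1 : η ∈ Icc 0 η := ⟨hη0.le, le_rfl⟩
  refine ⟨D, ⟨(p, _), (p, _), ?_, ?_, hmem _ h0, hmem _ h1, ?_⟩, ?_⟩
  · rw [hD, isUnitNormal_frontier_iff hKk']; exact hnormal _ h0
  · rw [hD, isUnitNormal_frontier_iff hKk']; exact hnormal _ h1
  · simp only [dist_self, mul_zero, dist_pos]
    intro h
    have h2 := congrArg (cross n) h
    have hc : cross n (rot n) = 1 := by
      rw [← inner_rot_left, real_inner_self_eq_norm_sq, hrn]; norm_num
    have hne : ‖n + η • rot n‖ ≠ 0 := by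
      intro h0
      rw [norm_eq_zero] at h0
      have h3 := congrArg (cross n) h0
      rw [cross_add_right, cross_self, cross_smul_right, hc] at h3
      simp [cross] at h3
      exact hη0.ne' h3
    simp only [cross_smul_right, cross_add_right, cross_self, hc] at h2
    simp at h2
    exact h2.elim (fun h => hne (by rw [h, norm_zero])) hη0.ne'
  · rw [dist_comm]; linarith

/-- Thickening a body by a ball makes it smooth, and robustly so. -/
lemma mem_closure_interior_smooth (C : ConvexCurve) {η : ℝ} (hη : 0 < η) :
    C ∈ closure (interior {D : ConvexCurve | ∀ z n n' : Plane, IsUnitNormal D.points z n →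
      IsUnitNormal D.points z n' → dist n n' ≤ η}) := by
  obtain ⟨K, hKc, hK, hKi, hKf⟩ := exists_body C
  rw [Metric.mem_closure_iff]
  intro ε hε
  set s := ε / 8 with hs
  have hs0 : 0 < s := by positivity
  have hball : IsCompact (closedBall (0 : Plane) s) := isCompact_closedBall 0 s
  obtain ⟨D, hD, hDC⟩ := exists_curve_of_subset hK hKc hKi hKf (hK.add hball)
    (hKc.add (convex_closedBall 0 s))
    (fun x hx => ⟨x, hx, 0, by simp [hs0.le], by simp⟩) hs0 (by
      rintro _ ⟨x, hx, t, ht, rfl⟩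
      refine ⟨x, hx, ?_⟩
      simpa using ht)
  refine ⟨D, ?_, by rw [dist_comm]; linarith⟩
  rw [mem_interior_iff_mem_nhds, Metric.mem_nhds_iff]
  set δ := s * η ^ 2 / 16 with hδ
  have hδ0 : 0 < δ := by positivity
  refine ⟨δ, hδ0, fun E hE z n n' hn hn' => ?_⟩
  rw [mem_ball] at hE
  obtain ⟨x, hx, hzx⟩ := exists_mem_points_dist_lt hn.mem hE
  rw [hD] at hx
  obtain ⟨y, hy, b, hb, hxyb⟩ := (hK.add hball).isClosed.frontier_subset hx
  have key : ∀ m, IsUnitNormal E.points z m → s * dist m (s⁻¹ • b) ≤ s * (η / 2) := by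
    intro m hm
    have hq : y + s • m ∈ K + closedBall (0 : Plane) s :=
      add_mem_add hy (by simp [norm_smul, hm.norm_eq, abs_of_pos hs0])
    have h1 : ⟪m, y + s • m⟫ ≤ ⟪m, z⟫ + δ := by
      refine inner_le_of_forall_frontier (hK.add hball) hm.ne_zero (fun c hc => ?_) hq
      rw [← hD] at hc
      obtain ⟨c', hc', hcc⟩ := exists_mem_points_dist_lt hc (dist_comm E D ▸ hE)
      have h1 := hm.inner_le' hc'
      have h2 := real_inner_le_norm m (c - c')
      rw [hm.norm_eq, one_mul, ← dist_eq_norm, inner_sub_right] at h2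
      linarith
    have h2 := real_inner_le_norm m (z - x)
    rw [hm.norm_eq, one_mul, ← dist_eq_norm, inner_sub_right, ← hxyb, inner_add_right] at h2
    rw [inner_add_right, inner_smul_right, real_inner_self_eq_norm_sq, hm.norm_eq] at h1
    have h3 : s - ⟪m, b⟫ ≤ 2 * δ := by
      rw [hxyb] at h2
      linarith
    have hbs : ‖b‖ ≤ s := by simpa using hb
    have h4 : ‖s • m - b‖ ^ 2 ≤ (s * (η / 2)) ^ 2 := by
      rw [norm_sub_sq_real, norm_smul, hm.norm_eq, real_inner_smul_left, Real.norm_eq_abs,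
        abs_of_pos hs0]
      have h5 : ‖b‖ ^ 2 ≤ s ^ 2 := by gcongr
      have h6 : 2 * s * (s - ⟪m, b⟫) ≤ 2 * s * (2 * δ) := by gcongr
      have h7 : 2 * s * (2 * δ) = (s * (η / 2)) ^ 2 := by rw [hδ]; ring
      nlinarith
    have h5 : ‖s • m - b‖ ≤ s * (η / 2) := by
      rwa [sq_le_sq₀ (norm_nonneg _) (by positivity)] at h4
    rw [dist_eq_norm]
    calc s * ‖m - s⁻¹ • b‖ = ‖s • (m - s⁻¹ • b)‖ := by
          rw [norm_smul, Real.norm_eq_abs, abs_of_pos hs0]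
      _ = ‖s • m - b‖ := by rw [smul_sub, smul_inv_smul₀ hs0.ne']
      _ ≤ _ := h5
  have h1 := le_of_mul_le_mul_left (key n hn) hs0
  have h2 := le_of_mul_le_mul_left (key n' hn') hs0
  linarith [dist_triangle_right n n' (s⁻¹ • b)]

/-- The properties of a typical convex curve on which the argument rests: it is smooth, and on no
arc is its curvature bounded from above, nor from below by a positive constant. -/
structure IsTypical (C : Set Plane) : Prop where
  smooth : ∀ z n n', IsUnitNormal C z n → IsUnitNormal C z n' → n = n'
  corner : ∀ z n, IsUnitNormal C z n → ∀ ε > 0, ∀ M : ℝ, ∃ a b : Plane × Plane,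
    IsUnitNormal C a.1 a.2 ∧ IsUnitNormal C b.1 b.2 ∧ dist a (z, n) < ε ∧ dist b (z, n) < ε ∧
      M * dist a.1 b.1 < dist a.2 b.2
  flat : ∀ z n, IsUnitNormal C z n → ∀ ε > 0, ∀ M : ℝ, ∃ a b : Plane × Plane,
    IsUnitNormal C a.1 a.2 ∧ IsUnitNormal C b.1 b.2 ∧ dist a (z, n) < ε ∧ dist b (z, n) < ε ∧
      M * dist a.2 b.2 < dist a.1 b.1

lemma eventually_smooth : ∀ᶠ C : ConvexCurve in residual ConvexCurve,
    ∀ z n n', IsUnitNormal C.points z n → IsUnitNormal C.points z n' → n = n' := by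
  have h : ∀ k : ℕ, ∀ᶠ C : ConvexCurve in residual ConvexCurve, ∀ z n n',
      IsUnitNormal C.points z n → IsUnitNormal C.points z n' → dist n n' ≤ 1 / ((k : ℝ) + 1) := by
    intro k
    refine mem_of_superset (residual_of_dense_open isOpen_interior fun C =>
      mem_closure_interior_smooth C (by positivity : 0 < 1 / ((k : ℝ) + 1))) interior_subset
  filter_upwards [eventually_countable_forall.2 h] with C hC z n n' hn hn'
  by_contra hne
  obtain ⟨k, hk⟩ := exists_nat_one_div_lt (dist_pos.2 hne)
  exact (hk.trans_le (hC k z n n' hn hn')).false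

lemma eventually_typical_of_mem_closure {f : (Plane × Plane) × (Plane × Plane) → ℝ}
    {g : (Plane × Plane) × (Plane × Plane) → ℝ} (hf : Continuous f) (hg : Continuous g)
    (hg0 : ∀ p, 0 ≤ g p)
    (h : ∀ (C : ConvexCurve) (z n : Plane) (B : Set (Plane × Plane)) (M : ℝ),
      IsUnitNormal C.points z n → IsOpen B → (z, n) ∈ B →
      C ∈ closure {D : ConvexCurve | ∃ a b : Plane × Plane, IsUnitNormal D.points a.1 a.2 ∧
        IsUnitNormal D.points b.1 b.2 ∧ (a ∈ B ∧ b ∈ B ∧ M * g (a, b) < f (a, b))}) :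
    ∀ᶠ C : ConvexCurve in residual ConvexCurve, ∀ z n, IsUnitNormal C.points z n →
      ∀ ε > 0, ∀ M : ℝ, ∃ a b : Plane × Plane, IsUnitNormal C.points a.1 a.2 ∧
        IsUnitNormal C.points b.1 b.2 ∧ dist a (z, n) < ε ∧ dist b (z, n) < ε ∧
        M * g (a, b) < f (a, b) := by
  set A : Set (Plane × Plane) → ℕ → Set ConvexCurve := fun B M =>
    {D : ConvexCurve | ∃ a b : Plane × Plane, IsUnitNormal D.points a.1 a.2 ∧
        IsUnitNormal D.points b.1 b.2 ∧ (a ∈ B ∧ b ∈ B ∧ M * g (a, b) < f (a, b))} with hA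
  have hopen : ∀ B, IsOpen B → ∀ M, IsOpen (A B M) := by
    intro B hB M
    exact isOpen_setOf_exists_normals (V := {p | p.1 ∈ B ∧ p.2 ∈ B ∧ M * g p < f p})
      ((hB.preimage continuous_fst).inter ((hB.preimage continuous_snd).inter
        (isOpen_lt (by fun_prop) hf)))
  have hcount := TopologicalSpace.countable_countableBasis (Plane × Plane)
  have hbasis := TopologicalSpace.isBasis_countableBasis (Plane × Plane)
  have hall : ∀ᶠ C : ConvexCurve in residual ConvexCurve,
      ∀ B ∈ TopologicalSpace.countableBasis (Plane × Plane), ∀ M : ℕ,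
        C ∈ closure (A B M) → C ∈ A B M := by
    rw [eventually_countable_ball hcount]
    intro B hB
    rw [eventually_countable_forall]
    exact fun M => eventually_residual_mem_of_mem_closure (hopen B (hbasis.isOpen hB) M)
  filter_upwards [hall] with C hC z n hn ε hε M
  obtain ⟨B, hB, hzB, hBε⟩ := hbasis.exists_subset_of_mem_open
    (mem_ball_self hε : (z, n) ∈ ball (z, n) ε) isOpen_ball
  obtain ⟨m, hm⟩ := exists_nat_ge M
  obtain ⟨a, b, ha, hb, haB, hbB, hab⟩ := hC B hB m (h C z n B m hn (hbasis.isOpen hB) hzB)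
  refine ⟨a, b, ha, hb, hBε haB, hBε hbB, lt_of_le_of_lt ?_ hab⟩
  exact mul_le_mul_of_nonneg_right hm (hg0 _)

/-- Typical convex curves form a comeagre set. -/
theorem eventually_isTypical : ∀ᶠ C : ConvexCurve in residual ConvexCurve,
    IsTypical C.points := by
  have h1 := eventually_typical_of_mem_closure (f := fun p => dist p.1.2 p.2.2)
    (g := fun p => dist p.1.1 p.2.1) (by fun_prop) (by fun_prop) (fun _ => dist_nonneg)
    fun C z n B M hn hB hz => mem_closure_corner hn hB hz M
  have h2 := eventually_typical_of_mem_closure (f := fun p => dist p.1.1 p.2.1)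
    (g := fun p => dist p.1.2 p.2.2) (by fun_prop) (by fun_prop) (fun _ => dist_nonneg)
    fun C z n B M hn hB hz => mem_closure_flat hn hB hz M
  filter_upwards [eventually_smooth, h1, h2] with C hs hc hf
  exact ⟨hs, hc, hf⟩

/-! ### Charts of the unit normals, and the mirror equation -/

lemma cross_rot_right (x y : Plane) : cross x (rot y) = ⟪x, y⟫ := by
  simp [inner_eq_coord, cross]

/-- A local parametrization `t ↦ (z t, n t)` of the unit normals of `K`. -/
structure IsChart (K : Set Plane) (z n : ℝ → Plane) (δ : ℝ) : Prop where
  pos : 0 < δ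
  continuous_z : Continuous z
  continuous_n : Continuous n
  normal : ∀ t, IsUnitNormal K (z t) (n t)
  half_le_inner : ∀ s ∈ Ioo (-δ) δ, ∀ t ∈ Ioo (-δ) δ, 1 / 2 ≤ ⟪n s, n t⟫
  mono : ∀ s ∈ Ioo (-δ) δ, ∀ t ∈ Ioo (-δ) δ, s < t → 0 ≤ cross (n s) (z t - z s) ∧
    0 ≤ cross (n s) (n t) ∧ 0 < cross (n s) (z t - z s) + cross (n s) (n t)
  surj : ∀ t, ∀ ε > 0, ∃ η > 0, ∀ a : Plane × Plane, IsUnitNormal K a.1 a.2 →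
    dist a (z t, n t) < η → ∃ s, dist s t < ε ∧ z s = a.1 ∧ n s = a.2

lemma IsUnitNormal.exists_chart {K : Set Plane} (hK : IsCompact K) (hKc : Convex ℝ K)
    {z₀ n₀ : Plane} (h : IsUnitNormal K z₀ n₀) :
    ∃ z n : ℝ → Plane, ∃ δ, IsChart K z n δ ∧ z 0 = z₀ ∧ n 0 = n₀ := by
  obtain ⟨P, hPc, hP⟩ := exists_continuous_nearest hK hKc ⟨z₀, h.mem⟩
  have hn0 := h.norm_eq
  have hnn : ⟪n₀, n₀⟫ = 1 := by rw [real_inner_self_eq_norm_sq, hn0]; norm_num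
  have hnr : ⟪n₀, rot n₀⟫ = 0 := by rw [real_inner_comm, inner_rot_left, cross_self]
  set w : ℝ → Plane := fun t => z₀ + n₀ + t • rot n₀ with hw
  have hwc : Continuous w := by fun_prop
  set z : ℝ → Plane := fun t => P (w t) with hz
  have hzc : Continuous z := hPc.comp hwc
  set g : ℝ → Plane := fun t => w t - z t with hg
  have hgc : Continuous g := hwc.sub hzc
  have hgin : ∀ t, 1 ≤ ⟪n₀, g t⟫ := by
    intro t
    have := h.inner_le (z t) (hP _).1
    have e : g t = n₀ + t • rot n₀ - (z t - z₀) := by simp only [hg, hw]; abel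
    rw [e, inner_sub_right, inner_add_right, inner_smul_right, hnn, hnr]
    linarith
  have hg0 : ∀ t, g t ≠ 0 := by
    intro t ht
    have := hgin t
    rw [ht, inner_zero_right] at this
    linarith
  have hgpos : ∀ t, 0 < ‖g t‖ := fun t => norm_pos_iff.2 (hg0 t)
  set n : ℝ → Plane := fun t => ‖g t‖⁻¹ • g t with hn
  have hnc : Continuous n := (hgc.norm.inv₀ fun t => (hgpos t).ne').smul hgc
  have hgn : ∀ t, g t = ‖g t‖ • n t := fun t => (smul_inv_smul₀ (hgpos t).ne' _).symm
  have hnorm : ∀ t, IsUnitNormal K (z t) (n t) := fun t =>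
    ⟨(hP _).1, norm_inv_norm_smul (hg0 t), fun x hx => by
      rw [hn, real_inner_smul_left]
      exact mul_nonpos_of_nonneg_of_nonpos (by positivity) ((hP (w t)).2 x hx)⟩
  have hnin : ∀ t, 0 < ⟪n₀, n t⟫ := by
    intro t
    rw [hn, inner_smul_right]
    exact mul_pos (inv_pos.2 (hgpos t)) (by linarith [hgin t])
  have hz0 : z 0 = z₀ := by
    refine nearest_unique (hP (w 0)).1 h.mem (hP (w 0)).2 fun x hx => ?_
    simpa [hw] using h.inner_le x hx
  have hn0' : n 0 = n₀ := by
    have : g 0 = n₀ := by simp only [hg]; rw [hz0]; simp [hw]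
    simp only [hn]; rw [this, hn0, inv_one, one_smul]
  obtain ⟨δ, hδ, hδn⟩ := Metric.continuous_iff.1 hnc 0 (1 / 2) (by norm_num)
  have hhalf : ∀ s ∈ Ioo (-δ) δ, ∀ t ∈ Ioo (-δ) δ, 1 / 2 ≤ ⟪n s, n t⟫ := by
    intro s hs t ht
    have h1 := hδn s (by rw [Real.dist_eq, sub_zero]; exact abs_lt.2 hs)
    have h2 := hδn t (by rw [Real.dist_eq, sub_zero]; exact abs_lt.2 ht)
    have h3 : ‖n s - n t‖ ≤ 1 := by
      rw [← dist_eq_norm]; linarith [dist_triangle_right (n s) (n t) (n 0)]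
    have h4 := norm_sub_sq_real (n s) (n t)
    rw [(hnorm s).norm_eq, (hnorm t).norm_eq] at h4
    nlinarith [norm_nonneg (n s - n t)]
  refine ⟨z, n, δ, ⟨hδ, hzc, hnc, hnorm, hhalf, ?_, ?_⟩, hz0, hn0'⟩
  · intro s hs t ht hst
    have h1 := (hnorm s).inner_le (z t) (hnorm t).mem
    have h2 := (hnorm t).inner_le (z s) (hnorm s).mem
    have hC := hhalf s hs t ht
    set d := z t - z s with hd
    have h2' : 0 ≤ ⟪n t, d⟫ := by
      rw [← neg_sub (z t), inner_neg_right] at h2; linarith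
    rw [inner_mul_add_cross_mul (hnorm s).norm_eq] at h2'
    set A := cross (n s) d
    set B := cross (n s) (n t)
    have hAB : 0 ≤ B * A := by nlinarith
    have hsum : 0 < A + ‖g t‖ * B := by
      have e1 : w t - w s = d + ‖g t‖ • n t - ‖g s‖ • n s := by
        rw [← hgn, ← hgn, hd]; simp only [hg]; abel
      have e2 : w t - w s = (t - s) • rot n₀ := by simp only [hw]; module
      have e3 := congrArg (cross (n s)) (e1.symm.trans e2)
      rw [cross_sub_right, cross_add_right, cross_smul_right ‖g t‖ (n s) (n t),
        cross_smul_right ‖g s‖ (n s) (n s), cross_smul_right (t - s), cross_self,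
        cross_rot_right, real_inner_comm] at e3
      have := mul_pos (sub_pos.2 hst) (hnin s)
      linarith
    have hr := hgpos t
    have hA : 0 ≤ A := by
      by_contra! hA
      have hB : 0 < B := by
        by_contra! hB
        nlinarith
      nlinarith
    have hB : 0 ≤ B := by
      by_contra! hB
      have : 0 < A := by nlinarith
      nlinarith
    refine ⟨hA, hB, ?_⟩
    rcases hA.eq_or_lt with hA' | hA'
    · have : 0 < B := by
        rw [← hA', zero_add] at hsum
        exact pos_of_mul_pos_right hsum hr.le
      linarith
    · linarith
  · intro t ε hε
    set σ : Plane × Plane → ℝ := fun a => (1 - ⟪n₀, a.1 - z₀⟫) / ⟪n₀, a.2⟫ with hσ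
    set G : Plane × Plane → ℝ := fun a => cross n₀ (a.1 + σ a • a.2 - (z₀ + n₀)) with hG
    have hσc : ContinuousAt σ (z t, n t) := by
      apply ContinuousAt.div
      · fun_prop
      · fun_prop
      · exact (hnin t).ne'
    have hGc : ContinuousAt G (z t, n t) := by
      have h1 : ContinuousAt (fun a : Plane × Plane => a.1 + σ a • a.2 - (z₀ + n₀)) (z t, n t) := by
        fun_prop
      have h2 : Continuous fun x : Plane => cross n₀ x := by fun_prop
      exact h2.continuousAt.comp h1
    have hσt : σ (z t, n t) = ‖g t‖ := by
      simp only [hσ]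
      rw [div_eq_iff (hnin t).ne']
      have e : g t = n₀ + t • rot n₀ - (z t - z₀) := by simp only [hg, hw]; abel
      have e2 := congrArg (fun x => ⟪n₀, x⟫) ((hgn t).symm.trans e)
      simp only [inner_sub_right, inner_add_right, inner_smul_right, hnn, hnr] at e2 ⊢
      linarith
    have hGt : G (z t, n t) = t := by
      simp only [hG]
      rw [hσt, ← hgn]
      have e : z t + g t - (z₀ + n₀) = t • rot n₀ := by simp only [hg, hw]; abel
      rw [e, cross_smul_right, cross_rot_right, hnn, mul_one]
    have hin : ∀ᶠ a : Plane × Plane in 𝓝 (z t, n t), 0 < ⟪n₀, a.2⟫ := by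
      have : Continuous fun a : Plane × Plane => ⟪n₀, a.2⟫ := by fun_prop
      exact this.continuousAt.eventually (lt_mem_nhds (hnin t))
    have hnear : ∀ᶠ a : Plane × Plane in 𝓝 (z t, n t), dist (G a) t < ε := by
      have := hGc.tendsto
      rw [hGt] at this
      exact this.eventually (ball_mem_nhds t hε)
    obtain ⟨η, hη, hball⟩ := Metric.eventually_nhds_iff.1 (hin.and hnear)
    refine ⟨η, hη, fun a ha hda => ⟨G a, (hball hda).2, ?_⟩⟩
    have ha2 := (hball hda).1
    have hσpos : 0 < σ a := by
      have := h.inner_le a.1 ha.mem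
      exact div_pos (by linarith) ha2
    have hwa : w (G a) = a.1 + σ a • a.2 := by
      have e := frame_expansion hn0 (a.1 + σ a • a.2 - (z₀ + n₀))
      have e1 : ⟪n₀, a.1 + σ a • a.2 - (z₀ + n₀)⟫ = 0 := by
        have : σ a * ⟪n₀, a.2⟫ = 1 - ⟪n₀, a.1 - z₀⟫ := div_mul_cancel₀ _ ha2.ne'
        simp only [inner_sub_right, inner_add_right, inner_smul_right, hnn] at this ⊢
        linarith
      rw [e1, zero_smul, zero_add] at e
      exact (sub_eq_iff_eq_add'.1 e).symm
    have hza : z (G a) = a.1 := by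
      refine nearest_unique (hP (w (G a))).1 ha.mem (hP (w (G a))).2 fun x hx => ?_
      rw [hwa, add_sub_cancel_left, real_inner_smul_left]
      exact mul_nonpos_of_nonneg_of_nonpos hσpos.le (ha.inner_le x hx)
    refine ⟨hza, ?_⟩
    have hga : g (G a) = σ a • a.2 := by
      simp only [hg]; rw [hza, hwa, add_sub_cancel_left]
    simp only [hn]
    rw [hga, norm_smul, ha.norm_eq, mul_one, Real.norm_eq_abs, abs_of_pos hσpos,
      inv_smul_smul₀ hσpos.ne']

/-- This quantity vanishes iff the lines from `z` to `u` and `v` are mirror images in the normal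
line spanned by `n`. -/
noncomputable def mirror (u v z n : Plane) : ℝ :=
  ⟪n, v - z⟫ * cross n (u - z) + cross n (v - z) * ⟪n, u - z⟫

@[fun_prop] lemma continuous_mirror {X : Type*} [TopologicalSpace X] {u v z n : X → Plane}
    (hu : Continuous u) (hv : Continuous v) (hz : Continuous z) (hn : Continuous n) :
    Continuous fun x => mirror (u x) (v x) (z x) (n x) := by
  unfold mirror; fun_prop

lemma mirror_frame {n₀ : Plane} (h : ‖n₀‖ = 1) {u v z₀ z₁ n₁ : Plane} {p q r A e B C : ℝ}
    (hv : v - z₀ = (-p) • n₀ + q • rot n₀) (hu : u - z₀ = (-(r * p)) • n₀ + (-(r * q)) • rot n₀)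
    (hz : z₁ - z₀ = (-e) • n₀ + A • rot n₀) (hn : n₁ = C • n₀ + B • rot n₀) :
    mirror u v z₁ n₁ = (A * (1 + r) * p - 2 * e * A + e * q * (1 - r)) * (C ^ 2 - B ^ 2) -
      2 * B * C * ((r * p - e) * (p - e) + (r * q + A) * (q - A)) := by
  have hv' : v - z₁ = (-p + e) • n₀ + (q - A) • rot n₀ := by
    rw [show v - z₁ = (v - z₀) - (z₁ - z₀) by abel, hv, hz]; module
  have hu' : u - z₁ = (-(r * p) + e) • n₀ + (-(r * q) - A) • rot n₀ := by
    rw [show u - z₁ = (u - z₀) - (z₁ - z₀) by abel, hu, hz]; module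
  unfold mirror
  rw [hv', hu', hn, inner_frame h, inner_frame h, cross_frame h, cross_frame h]
  ring

set_option maxHeartbeats 800000 in
lemma mirror_estimates {r p₀ D : ℝ} (hr : 0 < r) (hp₀ : 0 < p₀) (hD : 0 < D) :
    ∃ κ > 0, κ ≤ 1 / 2 ∧ ∃ M > 0, ∀ p q A e B C : ℝ, p₀ ≤ p → p ≤ D → |q| ≤ D → 0 ≤ A → A ≤ κ → 0 ≤ e →
      e ≤ 2 * (B * A) → 0 ≤ B → B ≤ κ → 1 / 2 ≤ C → C ^ 2 + B ^ 2 = 1 →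
      ((A * (1 + r) * p - 2 * e * A + e * q * (1 - r)) * (C ^ 2 - B ^ 2) -
        2 * B * C * ((r * p - e) * (p - e) + (r * q + A) * (q - A)) ≤ 0 → A ≤ M * B) ∧
      (0 ≤ (A * (1 + r) * p - 2 * e * A + e * q * (1 - r)) * (C ^ 2 - B ^ 2) -
        2 * B * C * ((r * p - e) * (p - e) + (r * q + A) * (q - A)) → B ≤ M * A) := by
  set κ := min (1 / 2) (min ((1 + r) * p₀ / (4 + 4 * D * (1 + r)))
    (r * p₀ ^ 2 / (2 * (2 * D * (1 + r) + 1)))) with hκ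
  set E := (r * D + 1) * (D + 1) with hE
  have hκ0 : 0 < κ := by positivity
  have hE0 : 0 < E := by positivity
  have hκ1 : κ ≤ 1 / 2 := min_le_left _ _
  have hκ2 : κ * (4 + 4 * D * (1 + r)) ≤ (1 + r) * p₀ := by
    rw [← le_div_iff₀ (by positivity)]; exact (min_le_right _ _).trans (min_le_left _ _)
  have hκ3 : κ * (2 * (2 * D * (1 + r) + 1)) ≤ r * p₀ ^ 2 := by
    rw [← le_div_iff₀ (by positivity)]; exact (min_le_right _ _).trans (min_le_right _ _)
  refine ⟨κ, hκ0, hκ1, max (16 * E / ((1 + r) * p₀)) (4 * (1 + r) * D / (r * p₀ ^ 2)), by positivity, ?_⟩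
  intro p q A e B C hp hpD hq hA hAκ he heB hB hBκ hC hCB
  have hpp : 0 < p := hp₀.trans_le hp
  have hC1 : C ≤ 1 := by nlinarith
  have hq' := abs_le.1 hq
  have hqr : |q * (1 - r)| ≤ D * (1 + r) := by
    rw [abs_mul]
    gcongr
    exact abs_le.2 ⟨by linarith, by linarith⟩
  have hqr' := abs_le.1 hqr
  have heA : e ≤ A := by nlinarith
  have hdiff1 : 1 / 2 ≤ C ^ 2 - B ^ 2 := by nlinarith
  have hdiff2 : C ^ 2 - B ^ 2 ≤ 1 := by nlinarith
  set I := A * (1 + r) * p - 2 * e * A + e * q * (1 - r) with hI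
  set R := (r * p - e) * (p - e) + (r * q + A) * (q - A) with hR
  constructor
  · intro hle
    have hIge : A * ((1 + r) * p₀ / 2) ≤ I := by
      have h1 : A * (1 + r) * p₀ ≤ A * (1 + r) * p := by gcongr
      have h2 : 2 * e * A ≤ 2 * (2 * (B * A)) * A := by gcongr
      have h3 : -(2 * (B * A) * (D * (1 + r))) ≤ e * (q * (1 - r)) := by
        have : e * (D * (1 + r)) ≤ 2 * (B * A) * (D * (1 + r)) := by gcongr
        have := mul_le_mul_of_nonneg_left hqr'.1 he
        linarith
      have h4 : A * (B * (4 * A + 2 * (D * (1 + r)))) ≤ A * ((1 + r) * p₀ / 2) := by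
        gcongr
        calc B * (4 * A + 2 * (D * (1 + r))) ≤ κ * (4 * (1 / 2) + 2 * (D * (1 + r))) := by
              gcongr; linarith
          _ ≤ _ := by linarith
      rw [hI]; linarith
    have hI0 : 0 ≤ I := le_trans (by positivity) hIge
    have hRle : R ≤ 2 * E := by
      have h1 : (r * p - e) * (p - e) ≤ E := by
        calc _ ≤ |(r * p - e) * (p - e)| := le_abs_self _
          _ ≤ E := by
            rw [abs_mul, hE]
            have : r * p ≤ r * D := by gcongr
            have : 0 < r * p := by positivity
            gcongr <;> exact abs_le.2 ⟨by linarith, by linarith⟩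
      have h2 : (r * q + A) * (q - A) ≤ E := by
        calc _ ≤ |(r * q + A) * (q - A)| := le_abs_self _
          _ ≤ E := by
            rw [abs_mul, hE]
            have : r * q ≤ r * D := by gcongr; exact hq'.2
            have : r * (-D) ≤ r * q := by gcongr; exact hq'.1
            gcongr <;> exact abs_le.2 ⟨by linarith, by linarith⟩
      linarith
    have h1 : A * ((1 + r) * p₀ / 2) * (1 / 2) ≤ I * (C ^ 2 - B ^ 2) := by gcongr
    have h2 : 2 * B * C * R ≤ 2 * B * (2 * E) := by
      have : 2 * B * C * R ≤ 2 * B * C * (2 * E) := by gcongr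
      have : 2 * B * C * (2 * E) ≤ 2 * B * 1 * (2 * E) := by gcongr
      linarith
    have h3 : A * ((1 + r) * p₀) ≤ 16 * E * B := by linarith
    have h4 : A ≤ 16 * E / ((1 + r) * p₀) * B := by
      rw [div_mul_eq_mul_div, le_div_iff₀ (by positivity)]; exact h3
    exact h4.trans (by gcongr; exact le_max_left _ _)
  · intro hge
    have hRge : r * p₀ ^ 2 / 2 ≤ R := by
      have h1 : r * p₀ ^ 2 ≤ r * p ^ 2 := by gcongr
      have h2 : e * p * (1 + r) ≤ A * D * (1 + r) := by gcongr
      have h3 : -(A * (D * (1 + r))) ≤ A * (q * (1 - r)) := by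
        have := mul_le_mul_of_nonneg_left hqr'.1 hA
        linarith
      have h4 : A * (2 * D * (1 + r) + 1) ≤ κ * (2 * D * (1 + r) + 1) := by gcongr
      have h5 : A ^ 2 ≤ A * 1 := by rw [sq]; gcongr; linarith
      have h6 : 0 ≤ r * q ^ 2 := by positivity
      have h7 : R = r * p ^ 2 + r * q ^ 2 - e * p * (1 + r) + e ^ 2 + A * (q * (1 - r)) - A ^ 2 := by
        rw [hR]; ring
      have h8 := sq_nonneg e
      rw [h7]; linarith
    have hIle : I ≤ 2 * A * (1 + r) * D := by
      have h1 : A * (1 + r) * p ≤ A * (1 + r) * D := by gcongr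
      have h2 : 0 ≤ e * A := by positivity
      have h3 : e * (q * (1 - r)) ≤ A * (D * (1 + r)) := by
        calc _ ≤ e * (D * (1 + r)) := mul_le_mul_of_nonneg_left hqr'.2 he
          _ ≤ _ := by gcongr
      rw [hI]; linarith
    have h1 : I * (C ^ 2 - B ^ 2) ≤ 2 * A * (1 + r) * D := by
      calc _ ≤ 2 * A * (1 + r) * D * (C ^ 2 - B ^ 2) := by gcongr
        _ ≤ 2 * A * (1 + r) * D * 1 := by gcongr
        _ = _ := mul_one _
    have h2 : B * (r * p₀ ^ 2 / 2) ≤ 2 * B * C * R := by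
      calc B * (r * p₀ ^ 2 / 2) = 2 * B * (1 / 2) * (r * p₀ ^ 2 / 2) := by ring
        _ ≤ _ := by gcongr
    have h3 : B * (r * p₀ ^ 2) ≤ 4 * (1 + r) * D * A := by linarith
    have h4 : B ≤ 4 * (1 + r) * D / (r * p₀ ^ 2) * A := by
      rw [div_mul_eq_mul_div, le_div_iff₀ (by positivity)]; exact h3
    exact h4.trans (by gcongr; exact le_max_right _ _)

/-! ### Images in the mirror and zeros of `mirror` -/

lemma mem_mk'_orthogonal {z m x : Plane} :
    x ∈ AffineSubspace.mk' z (Submodule.span ℝ {m})ᗮ ↔ ⟪m, x - z⟫ = 0 := by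
  rw [AffineSubspace.mem_mk', Submodule.mem_orthogonal_singleton_iff_inner_right, vsub_eq_sub]

lemma finrank_orthogonal_span {m : Plane} (hm : m ≠ 0) :
    Module.finrank ℝ (Submodule.span ℝ {m})ᗮ = 1 := by
  have h := Submodule.finrank_add_finrank_orthogonal (Submodule.span ℝ {m})
  rw [finrank_span_singleton hm, finrank_euclideanSpace_fin] at h
  omega

lemma sub_inner_smul_mem {z m x : Plane} (hm : ‖m‖ = 1) :
    x - ⟪m, x - z⟫ • m ∈ AffineSubspace.mk' z (Submodule.span ℝ {m})ᗮ := by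
  rw [mem_mk'_orthogonal, sub_right_comm, inner_sub_right, inner_smul_right,
    real_inner_self_eq_norm_sq, hm]
  ring

lemma sameRay_smul_smul {m : Plane} {a b : ℝ} (h : 0 ≤ a * b) : SameRay ℝ (a • m) (b • m) := by
  rcases eq_or_ne a 0 with rfl | ha
  · simp
  rcases eq_or_ne b 0 with rfl | hb
  · simp
  refine Or.inr (Or.inr ?_)
  refine ⟨b ^ 2, a * b, by positivity, lt_of_le_of_ne h (by positivity), ?_⟩
  rw [smul_smul, smul_smul]; congr 1; ring

lemma wSameSide_of_inner {z m x y : Plane} (hm : ‖m‖ = 1)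
    (h : 0 ≤ ⟪m, x - z⟫ * ⟪m, y - z⟫) :
    (AffineSubspace.mk' z (Submodule.span ℝ {m})ᗮ).WSameSide x y := by
  refine ⟨_, sub_inner_smul_mem hm (x := x), _, sub_inner_smul_mem hm (x := y), ?_⟩
  simp only [vsub_eq_sub, sub_sub_cancel]
  exact sameRay_smul_smul h

lemma sOppSide_of_inner {z m x y : Plane} (hm : ‖m‖ = 1) (hx : ⟪m, x - z⟫ < 0)
    (hy : 0 < ⟪m, y - z⟫) :
    (AffineSubspace.mk' z (Submodule.span ℝ {m})ᗮ).SOppSide x y := by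
  refine ⟨⟨_, sub_inner_smul_mem hm (x := x), _, sub_inner_smul_mem hm (x := y), ?_⟩, ?_, ?_⟩
  · simp only [vsub_eq_sub, sub_sub_cancel, sub_sub_cancel_left, ← neg_smul]
    exact sameRay_smul_smul (by nlinarith)
  · rw [mem_mk'_orthogonal]; exact hx.ne
  · rw [mem_mk'_orthogonal]; exact hy.ne'

lemma not_sOppSide_of_inner {z m x y : Plane} (hx : ⟪m, x - z⟫ ≤ 0) (hy : ⟪m, y - z⟫ ≤ 0) :
    ¬ (AffineSubspace.mk' z (Submodule.span ℝ {m})ᗮ).SOppSide x y := by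
  rintro ⟨⟨p, hp, q, hq, hpq⟩, hxT, hyT⟩
  rw [mem_mk'_orthogonal] at hp hq hxT hyT
  simp only [vsub_eq_sub] at hpq
  have hx' := lt_of_le_of_ne hx hxT
  have hy' := lt_of_le_of_ne hy hyT
  have h1 : ⟪m, x - p⟫ < 0 := by
    simp only [inner_sub_right] at *; linarith
  have h2 : 0 < ⟪m, q - y⟫ := by
    simp only [inner_sub_right] at *; linarith
  rcases hpq with h | h | ⟨a, b, ha, hb, h⟩
  · rw [h, inner_zero_right] at h1; exact h1.false
  · rw [h, inner_zero_right] at h2; exact h2.false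
  · have := congrArg (fun w => ⟪m, w⟫) h
    simp only [inner_smul_right] at this
    nlinarith

lemma exists_normal_of_finrank_eq_one {T : AffineSubspace ℝ Plane} {z : Plane} (hz : z ∈ T)
    (hT : Module.finrank ℝ T.direction = 1) :
    ∃ m : Plane, ‖m‖ = 1 ∧ T = AffineSubspace.mk' z (Submodule.span ℝ {m})ᗮ := by
  have h := Submodule.finrank_add_finrank_orthogonal T.direction
  rw [hT, finrank_euclideanSpace_fin] at h
  have hne : T.directionᗮ ≠ ⊥ := by
    intro h0; rw [h0, finrank_bot] at h; omega
  obtain ⟨m, hm, hm0⟩ := Submodule.exists_mem_ne_zero_of_ne_bot hne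
  refine ⟨‖m‖⁻¹ • m, norm_inv_norm_smul hm0, ?_⟩
  have hm1 : ‖m‖⁻¹ • m ≠ 0 := by
    rw [← norm_ne_zero_iff, norm_inv_norm_smul hm0]; norm_num
  rw [← AffineSubspace.mk'_eq hz]
  congr 1
  apply Submodule.eq_of_le_of_finrank_eq
  · intro x hx
    rw [Submodule.mem_orthogonal_singleton_iff_inner_right, real_inner_smul_left,
      (Submodule.mem_orthogonal' _ _).1 hm x hx, mul_zero]
  · rw [hT, finrank_orthogonal_span hm1]

lemma isTangentLine_of_isUnitNormal {C : Set Plane} {z n : Plane} (h : IsUnitNormal C z n) :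
    IsTangentLine C z (AffineSubspace.mk' z (Submodule.span ℝ {n})ᗮ) := by
  refine ⟨?_, AffineSubspace.self_mem_mk' _ _, fun x hx y hy =>
    not_sOppSide_of_inner (h.inner_le x hx) (h.inner_le y hy)⟩
  rw [AffineSubspace.direction_mk', finrank_orthogonal_span h.ne_zero]

lemma tangentLine_eq_of_smooth {C : Set Plane} {z n : Plane} (h : IsUnitNormal C z n)
    (hC : ∀ n', IsUnitNormal C z n' → n = n') {T : AffineSubspace ℝ Plane}
    (hT : IsTangentLine C z T) : T = AffineSubspace.mk' z (Submodule.span ℝ {n})ᗮ := by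
  obtain ⟨h1, hz, hopp⟩ := hT
  obtain ⟨m, hm, rfl⟩ := exists_normal_of_finrank_eq_one hz h1
  by_cases hle : ∀ x ∈ C, ⟪m, x - z⟫ ≤ 0
  · rw [hC m ⟨h.mem, hm, hle⟩]
  · push Not at hle
    obtain ⟨y, hy, hy0⟩ := hle
    have hge : ∀ x ∈ C, 0 ≤ ⟪m, x - z⟫ := by
      intro x hx
      by_contra! hx0
      exact hopp x hx y hy (sOppSide_of_inner hm hx0 hy0)
    have := hC (-m) ⟨h.mem, by rw [norm_neg, hm], fun x hx => by
      rw [inner_neg_left]; linarith [hge x hx]⟩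
    rw [this, ← Set.neg_singleton, Submodule.span_neg]

lemma arccos_two_mul_sq_sub_one {k : ℝ} (h0 : 0 ≤ k) (h1 : k ≤ 1) :
    Real.arccos (2 * k ^ 2 - 1) = 2 * Real.arccos k := by
  have h : Real.cos (2 * Real.arccos k) = 2 * k ^ 2 - 1 := by
    rw [Real.cos_two_mul, Real.cos_arccos (by linarith) h1]
  rw [← h, Real.arccos_cos (by linarith [Real.arccos_nonneg k])]
  linarith [Real.arccos_le_pi_div_two.2 h0]

lemma halvesAngle_of_mirror_eq_zero {u v z n : Plane} (hn : ‖n‖ = 1) (hu : ⟪n, u - z⟫ < 0)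
    (hv : ⟪n, v - z⟫ < 0) (h : mirror u v z n = 0) :
    HalvesAngle (AffineSubspace.mk' z (Submodule.span ℝ {n})) u z v := by
  set x := u - z with hx
  set y := v - z with hy
  have hxx := norm_sq_frame hn x
  have hyy := norm_sq_frame hn y
  have hxy := inner_mul_add_cross_mul hn x y
  unfold mirror at h
  rw [← hx, ← hy] at h
  set a := ⟪n, x⟫
  set b := cross n x
  set c := ⟪n, y⟫
  set d := cross n y
  have hxpos : 0 < ‖x‖ := by
    refine norm_pos_iff.2 fun h0 => ?_
    have : a = 0 := by simp only [a, h0, inner_zero_right]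
    linarith
  have hypos : 0 < ‖y‖ := by
    refine norm_pos_iff.2 fun h0 => ?_
    have : c = 0 := by simp only [c, h0, inner_zero_right]
    linarith
  have hratio : c * ‖x‖ = a * ‖y‖ := by
    have h1 : (-c * ‖x‖) ^ 2 = (-a * ‖y‖) ^ 2 := by
      rw [mul_pow, mul_pow, hxx, hyy]
      linear_combination (c * b - d * a) * h
    have h2 : -c * ‖x‖ = -a * ‖y‖ := by
      rwa [sq_eq_sq₀ (mul_nonneg (by linarith) hxpos.le) (mul_nonneg (by linarith) hypos.le)] at h1
    linarith
  have hprod : ‖x‖ * ‖y‖ = a * c - b * d := by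
    have : a * (‖x‖ * ‖y‖) = a * (a * c - b * d) := by
      linear_combination (-‖x‖) * hratio + c * hxx + b * h
    exact mul_left_cancel₀ hu.ne this
  set k := -a / ‖x‖ with hk
  have hk' : k = -c / ‖y‖ := by
    rw [hk, div_eq_div_iff hxpos.ne' hypos.ne']; linarith
  have hk0 : 0 ≤ k := div_nonneg (by linarith) hxpos.le
  have hk1 : k ≤ 1 := by
    rw [hk, div_le_one hxpos]
    have : |a| ≤ ‖n‖ * ‖x‖ := abs_real_inner_le_norm _ _
    rw [hn, one_mul] at this
    linarith [neg_le_abs a]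
  have hang : ∠ u z v = 2 * Real.arccos k := by
    rw [← arccos_two_mul_sq_sub_one hk0 hk1]
    unfold EuclideanGeometry.angle InnerProductGeometry.angle
    simp only [vsub_eq_sub]
    rw [← hx, ← hy, hxy]
    congr 1
    rw [sq]
    nth_rewrite 2 [hk']
    rw [hk, div_mul_div_comm, div_eq_iff (by positivity), sub_mul, ← mul_div_assoc,
      div_mul_cancel₀ _ (by positivity)]
    linear_combination hprod
  refine ⟨z - n, ?_, ?_, ?_, ?_⟩
  · rw [AffineSubspace.mem_mk', vsub_eq_sub, sub_sub_cancel_left]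
    exact neg_mem (Submodule.mem_span_singleton_self n)
  · intro h0
    have : n = 0 := by simpa using h0
    rw [this] at hn; simp at hn
  · rw [hang, mul_div_cancel_left₀ _ two_ne_zero]
    unfold EuclideanGeometry.angle InnerProductGeometry.angle
    simp only [vsub_eq_sub, sub_sub_cancel_left]
    rw [← hx, inner_neg_right, real_inner_comm, norm_neg, hn, mul_one]
  · rw [hang, mul_div_cancel_left₀ _ two_ne_zero]
    unfold EuclideanGeometry.angle InnerProductGeometry.angle
    simp only [vsub_eq_sub, sub_sub_cancel_left]
    rw [← hy, inner_neg_left, norm_neg, hn, one_mul, hk']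

/-- Zeros of `mirror` on the right side of the tangent line of a smooth curve yield images. -/
lemma seesImageVia_of_mirror_eq_zero {C : Set Plane} {u v z n : Plane} (h : IsUnitNormal C z n)
    (hC : ∀ n', IsUnitNormal C z n' → n = n') (hu : ⟪n, u - z⟫ < 0) (hv : ⟪n, v - z⟫ < 0)
    (h0 : mirror u v z n = 0) : SeesImageVia C u v z := by
  refine ⟨h.mem, AffineSubspace.mk' z (Submodule.span ℝ {n})ᗮ, isTangentLine_of_isUnitNormal h,
    fun T hT => tangentLine_eq_of_smooth h hC hT, ⟨?_, ?_, ?_⟩, fun x hx => ?_, ?_⟩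
  · exact wSameSide_of_inner h.norm_eq (mul_pos_of_neg_of_neg hu hv).le
  · rw [mem_mk'_orthogonal]; exact hu.ne
  · rw [mem_mk'_orthogonal]; exact hv.ne
  · exact wSameSide_of_inner h.norm_eq (mul_nonneg_of_nonpos_of_nonpos hu.le (h.inner_le x hx))
  · unfold normalLine
    rw [AffineSubspace.direction_mk', Submodule.orthogonal_orthogonal]
    exact halvesAngle_of_mirror_eq_zero h.norm_eq hu hv h0

/-! ### Existence of one image -/

lemma not_forall_dist_add_dist_le {K : Set Plane} (hK : (interior K).Nonempty) (u v : Plane) :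
    ¬ ∀ x ∈ K, dist x u + dist x v ≤ dist u v := by
  intro h
  obtain ⟨y, hy⟩ := hK
  obtain ⟨g, hg0, hg⟩ : ∃ g : Plane, g ≠ 0 ∧ ⟪g, v - u⟫ = 0 := by
    rcases eq_or_ne (v - u) 0 with h0 | h0
    · obtain ⟨g, hg⟩ := exists_ne (0 : Plane)
      exact ⟨g, hg, by rw [h0, inner_zero_right]⟩
    · refine ⟨rot (v - u), ?_, by rw [inner_rot_left, cross_self]⟩
      rwa [← norm_ne_zero_iff, norm_rot, norm_ne_zero_iff]
  have hline : ∀ x ∈ K, ⟪g, x - u⟫ = 0 := by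
    intro x hx
    have h1 : dist u x + dist x v = dist u v := by
      refine le_antisymm ?_ (dist_triangle _ _ _)
      rw [dist_comm u x]; exact h x hx
    obtain ⟨t, -, rfl⟩ := dist_add_dist_eq_iff.1 h1
    rw [AffineMap.lineMap_apply, vsub_eq_sub, vadd_eq_add, add_sub_cancel_right, inner_smul_right,
      hg, mul_zero]
  refine not_mem_interior_of_inner_le (K := K) hg0 (fun x hx => ?_) hy
  have h1 := hline x hx
  have h2 := hline y (interior_subset hy)
  simp only [inner_sub_right] at *
  linarith

/-- A point of `K` farthest from `u` and `v`, in the sense of the sum of distances, reflects. -/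
lemma exists_mirror_eq_zero {K : Set Plane} (hK : IsCompact K) (hKi : (interior K).Nonempty)
    (u v : Plane) : ∃ z n, IsUnitNormal K z n ∧ ⟪n, u - z⟫ < 0 ∧ ⟪n, v - z⟫ < 0 ∧
      mirror u v z n = 0 := by
  obtain ⟨z, hz, hmax⟩ := hK.exists_isMaxOn (hKi.mono interior_subset)
    (f := fun x => dist x u + dist x v) (by fun_prop)
  have hmax : ∀ x ∈ K, dist x u + dist x v ≤ dist z u + dist z v := fun x hx => hmax hx
  have hlt : dist u v < dist z u + dist z v := by
    by_contra! hle
    exact not_forall_dist_add_dist_le hKi u v fun x hx => (hmax x hx).trans hle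
  have ha0 : z - u ≠ 0 := by
    intro h; rw [sub_eq_zero.1 h, dist_self, zero_add] at hlt; exact hlt.false
  have hb0 : z - v ≠ 0 := by
    intro h; rw [sub_eq_zero.1 h, dist_self, add_zero, dist_comm] at hlt; exact hlt.false
  rw [dist_eq_norm z, dist_eq_norm z, dist_eq_norm, show u - v = (z - v) - (z - u) by abel] at hlt
  have hmax : ∀ x ∈ K, ‖(x - z) + (z - u)‖ + ‖(x - z) + (z - v)‖ ≤ ‖z - u‖ + ‖z - v‖ := by
    simpa only [sub_add_sub_cancel, dist_eq_norm] using hmax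
  have hu : u - z = -(z - u) := by abel
  have hv : v - z = -(z - v) := by abel
  generalize z - u = a at *
  generalize z - v = b at *
  have hapos : 0 < ‖a‖ := norm_pos_iff.2 ha0
  have hbpos : 0 < ‖b‖ := norm_pos_iff.2 hb0
  have haa : a = ‖a‖ • (‖a‖⁻¹ • a) := (smul_inv_smul₀ hapos.ne' _).symm
  have hbb : b = ‖b‖ • (‖b‖⁻¹ • b) := (smul_inv_smul₀ hbpos.ne' _).symm
  have ha1 := norm_inv_norm_smul ha0
  have hb1 := norm_inv_norm_smul hb0
  set a' := ‖a‖⁻¹ • a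
  set b' := ‖b‖⁻¹ • b
  set G := a' + b' with hG
  have hG0 : G ≠ 0 := by
    intro h
    have hab : a' = -b' := eq_neg_of_add_eq_zero_left h
    have : b - a = (‖b‖ + ‖a‖) • b' := by
      nth_rewrite 1 [hbb]
      nth_rewrite 1 [haa]
      rw [hab]; module
    rw [this, norm_smul, hb1, mul_one, Real.norm_eq_abs, abs_of_pos (by positivity)] at hlt
    linarith
  have hGpos : 0 < ‖G‖ := norm_pos_iff.2 hG0
  have haa' : ⟪a', a'⟫ = 1 := by rw [real_inner_self_eq_norm_sq, ha1]; norm_num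
  have hbb' : ⟪b', b'⟫ = 1 := by rw [real_inner_self_eq_norm_sq, hb1]; norm_num
  have hGa : ⟪G, a'⟫ = 1 + ⟪a', b'⟫ := by
    rw [hG, inner_add_left, haa', real_inner_comm]
  have hGb : ⟪G, b'⟫ = 1 + ⟪a', b'⟫ := by
    rw [hG, inner_add_left, hbb', add_comm]
  have hc : 0 < 1 + ⟪a', b'⟫ := by
    have h1 : ‖G‖ ^ 2 = ⟪G, a'⟫ + ⟪G, b'⟫ := by
      rw [← inner_add_right, ← hG, real_inner_self_eq_norm_sq]
    have : 0 < ‖G‖ ^ 2 := by positivity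
    linarith
  have hsub : ∀ c : Plane, ‖‖c‖⁻¹ • c‖ = 1 → c = ‖c‖ • (‖c‖⁻¹ • c) →
      ∀ x, ‖c‖ + ⟪‖c‖⁻¹ • c, x⟫ ≤ ‖x + c‖ := by
    intro c hc1 hcc x
    have h1 := real_inner_le_norm (‖c‖⁻¹ • c) (x + c)
    rw [hc1, one_mul, inner_add_right] at h1
    have h2 : ⟪‖c‖⁻¹ • c, c⟫ = ‖c‖ := by
      nth_rewrite 3 [hcc]
      rw [inner_smul_right, real_inner_self_eq_norm_sq, hc1]; ring
    linarith
  have hnormal : ∀ x ∈ K, ⟪G, x - z⟫ ≤ 0 := by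
    intro x hx
    have h1 := hsub a ha1 haa (x - z)
    have h2 := hsub b hb1 hbb (x - z)
    have h3 := hmax x hx
    rw [hG, inner_add_left]
    linarith
  refine ⟨z, ‖G‖⁻¹ • G, ⟨hz, norm_inv_norm_smul hG0, fun x hx => ?_⟩, ?_, ?_, ?_⟩
  · rw [real_inner_smul_left]
    exact mul_nonpos_of_nonneg_of_nonpos (by positivity) (hnormal x hx)
  · rw [hu, haa, real_inner_smul_left, inner_neg_right, inner_smul_right, hGa]
    have : 0 < ‖G‖⁻¹ * (‖a‖ * (1 + ⟪a', b'⟫)) := by positivity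
    linarith
  · rw [hv, hbb, real_inner_smul_left, inner_neg_right, inner_smul_right, hGb]
    have : 0 < ‖G‖⁻¹ * (‖b‖ * (1 + ⟪a', b'⟫)) := by positivity
    linarith
  · unfold mirror
    rw [hu, hv, haa, hbb]
    have hcr : cross G a' + cross G b' = 0 := by rw [← cross_add_right, ← hG, cross_self]
    have hsm : ∀ x, cross (‖G‖⁻¹ • G) x = ‖G‖⁻¹ * cross G x := by
      intro x; simp [cross]; ring
    simp only [← neg_smul, real_inner_smul_left, inner_smul_right, cross_smul_right, hsm, hGa, hGb]
    linear_combination (‖G‖⁻¹ ^ 2 * ‖a‖ * ‖b‖ * (1 + ⟪a', b'⟫)) * hcr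

/-! ### Sign changes -/

lemma mirror_dist_estimates {r p₀ D : ℝ} (hr : 0 < r) (hp₀ : 0 < p₀) (hD : 0 < D) :
    ∃ κ > 0, ∃ M > 0, ∀ {K : Set Plane} {z₀ n₀ z₁ n₁ u v : Plane}, IsUnitNormal K z₀ n₀ →
      IsUnitNormal K z₁ n₁ → 0 ≤ cross n₀ (z₁ - z₀) → 0 ≤ cross n₀ n₁ → 1 / 2 ≤ ⟪n₀, n₁⟫ →
      p₀ ≤ -⟪n₀, v - z₀⟫ → -⟪n₀, v - z₀⟫ ≤ D → |cross n₀ (v - z₀)| ≤ D → dist z₀ z₁ < κ →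
      dist n₀ n₁ < κ → u - z₀ = (-(r * -⟪n₀, v - z₀⟫)) • n₀ + (-(r * cross n₀ (v - z₀))) • rot n₀ →
      (mirror u v z₁ n₁ ≤ 0 → dist z₀ z₁ ≤ M * dist n₀ n₁) ∧
      (0 ≤ mirror u v z₁ n₁ → dist n₀ n₁ ≤ M * dist z₀ z₁) := by
  obtain ⟨κ, hκ, hκ2, M, hM, hest⟩ := mirror_estimates hr hp₀ hD
  refine ⟨κ, hκ, 2 * M, by positivity, ?_⟩
  intro K z₀ n₀ z₁ n₁ u v h₀ h₁ hA hB hC hp hpD hq hdz hdn hu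
  have hn1 := h₀.norm_eq
  have hn2 := h₁.norm_eq
  have he := h₀.inner_le _ h₁.mem
  have he2 := h₁.inner_le _ h₀.mem
  rw [← neg_sub z₁, inner_neg_right, inner_mul_add_cross_mul hn1] at he2
  have hexp := frame_expansion hn1 (z₁ - z₀)
  have hexpn := frame_expansion hn1 n₁
  have hexpv := frame_expansion hn1 (v - z₀)
  have hsqn := norm_sq_frame hn1 n₁
  rw [hn2] at hsqn
  have hAle := (le_abs_self _).trans (abs_cross_le n₀ (z₁ - z₀))
  rw [hn1, one_mul, ← dist_eq_norm, dist_comm] at hAle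
  have hBle : cross n₀ n₁ ≤ dist n₀ n₁ := by
    rw [← cross_sub_self_right, dist_comm, dist_eq_norm]
    refine (le_abs_self _).trans ((abs_cross_le _ _).trans ?_)
    rw [hn1, one_mul]
  have hdzle : dist z₀ z₁ ≤ |⟪n₀, z₁ - z₀⟫| + cross n₀ (z₁ - z₀) := by
    rw [dist_comm, dist_eq_norm]
    nth_rewrite 1 [hexp]
    refine (norm_add_le _ _).trans ?_
    rw [norm_smul, norm_smul, norm_rot, hn1, mul_one, mul_one, Real.norm_eq_abs,
      Real.norm_eq_abs, abs_of_nonneg hA]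
  rw [abs_of_nonpos he] at hdzle
  have hdnle : dist n₀ n₁ ^ 2 = 2 - 2 * ⟪n₀, n₁⟫ := by
    rw [dist_eq_norm, norm_sub_sq_real, hn1, hn2]; ring
  rw [← neg_neg ⟪n₀, v - z₀⟫] at hexpv
  rw [← neg_neg ⟪n₀, z₁ - z₀⟫] at hexp he he2
  have hmir := mirror_frame hn1 hexpv hu hexp hexpn
  clear hexp hexpn hexpv hu
  generalize cross n₀ (z₁ - z₀) = A at *
  generalize cross n₀ n₁ = B at *
  generalize ⟪n₀, n₁⟫ = C at *
  generalize -⟪n₀, z₁ - z₀⟫ = e at *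
  have he0 : 0 ≤ e := by linarith
  have hBA0 : 0 ≤ B * A := mul_nonneg hB hA
  have heB : e ≤ 2 * (B * A) := by
    have : 1 / 2 * e ≤ C * e := by gcongr
    linarith
  have hBκ : B ≤ 1 / 2 := by linarith
  have hC1 : C ≤ 1 := by nlinarith
  obtain ⟨h1, h2⟩ := hest _ _ A e B C hp hpD hq hA (by linarith) he0 heB hB (by linarith) hC
    (by linarith)
  rw [← hmir] at h1 h2
  constructor
  · intro hle
    have hm : M * B ≤ M * dist n₀ n₁ := by gcongr
    have hBA : B * A ≤ 1 / 2 * A := by gcongr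
    linarith [h1 hle]
  · intro hge
    have hm : M * A ≤ M * dist z₀ z₁ := by gcongr
    have h3 : dist n₀ n₁ ^ 2 ≤ (2 * B) ^ 2 := by
      have : 0 ≤ (1 - C) * C := mul_nonneg (by linarith) (by linarith)
      nlinarith
    have h4 : dist n₀ n₁ ≤ 2 * B := by
      rwa [sq_le_sq₀ dist_nonneg (by linarith)] at h3
    linarith [h2 hge]

lemma exists_perturbation {u u₀ v z₀ n₀ z₁ n₁ : Plane} {ε τ : ℝ} (hn : ‖n₀‖ = 1) (hτ : τ ≠ 0)
    (hv : ⟪n₀, v - z₀⟫ < 0) (h0 : mirror u v z₀ n₀ = 0) (h1 : 0 < τ * mirror u v z₁ n₁)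
    (hd : dist u u₀ < ε) :
    ∃ u', dist u' u₀ < ε ∧ τ * mirror u' v z₀ n₀ < 0 ∧ 0 < τ * mirror u' v z₁ n₁ := by
  have hc : Continuous fun s : ℝ => u + (s * τ) • rot n₀ := by fun_prop
  have hnn : ⟪n₀, n₀⟫ = 1 := by rw [real_inner_self_eq_norm_sq, hn]; norm_num
  have e1 : ∀ᶠ s : ℝ in 𝓝 0, dist (u + (s * τ) • rot n₀) u₀ < ε := by
    have : Continuous fun s : ℝ => dist (u + (s * τ) • rot n₀) u₀ := by fun_prop
    exact this.continuousAt.eventually (gt_mem_nhds (by simpa using hd))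
  have e2 : ∀ᶠ s : ℝ in 𝓝 0, 0 < τ * mirror (u + (s * τ) • rot n₀) v z₁ n₁ := by
    have : Continuous fun s : ℝ => τ * mirror (u + (s * τ) • rot n₀) v z₁ n₁ := by fun_prop
    exact this.continuousAt.eventually (lt_mem_nhds (by simpa using h1))
  obtain ⟨s, ⟨hs1, hs2⟩, hs0⟩ := (((e1.and e2).filter_mono nhdsWithin_le_nhds).and
    (self_mem_nhdsWithin : ∀ᶠ s : ℝ in 𝓝[>] 0, s ∈ Ioi 0)).exists
  refine ⟨_, hs1, ?_, hs2⟩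
  have h2 : mirror (u + (s * τ) • rot n₀) v z₀ n₀ = s * τ * ⟪n₀, v - z₀⟫ := by
    have e : u + (s * τ) • rot n₀ - z₀ = (u - z₀) + (s * τ) • rot n₀ := by abel
    have hnr : ⟪n₀, rot n₀⟫ = 0 := by rw [real_inner_comm, inner_rot_left, cross_self]
    unfold mirror at *
    rw [e, cross_add_right, cross_smul_right, cross_rot_right, hnn, inner_add_right,
      inner_smul_right, hnr]
    linear_combination h0
  rw [h2]
  have : 0 < s * τ ^ 2 := mul_pos hs0 (by positivity)
  nlinarith

lemma IsChart.exists_sign_changes {K : Set Plane} {z n : ℝ → Plane} {δ : ℝ}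
    (hK : IsTypical K) (hch : IsChart K z n δ) {u₀ v : Plane} {t₀ : ℝ} (ht₀ : t₀ ∈ Ioo (-δ) δ)
    (hu : ⟪n t₀, u₀ - z t₀⟫ < 0) (hv : ⟪n t₀, v - z t₀⟫ < 0)
    (h0 : mirror u₀ v (z t₀) (n t₀) = 0) {ε : ℝ} (hε : 0 < ε) {τ : ℝ} (hτ : τ ≠ 0) :
    ∃ u, dist u u₀ < ε ∧ ∃ x y, dist x t₀ < ε ∧ dist y t₀ < ε ∧ x < y ∧
      τ * mirror u v (z x) (n x) < 0 ∧ 0 < τ * mirror u v (z y) (n y) := by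
  have hzc := hch.continuous_z
  have hnc := hch.continuous_n
  set p : ℝ → ℝ := fun t => -⟪n t, v - z t⟫ with hp
  set q : ℝ → ℝ := fun t => cross (n t) (v - z t) with hq
  have hpc : Continuous p := by fun_prop
  have hqc : Continuous q := by fun_prop
  have hp0 : 0 < p t₀ := by simp only [hp]; linarith
  set r := ⟪n t₀, u₀ - z t₀⟫ / ⟪n t₀, v - z t₀⟫ with hr
  have hr0 : 0 < r := div_pos_of_neg_of_neg hu hv
  set U : ℝ → Plane := fun t => z t + ((-(r * p t)) • n t + (-(r * q t)) • rot (n t)) with hU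
  have hUc : Continuous U := by fun_prop
  have hUt : U t₀ = u₀ := by
    have e := frame_expansion (hch.normal t₀).norm_eq (u₀ - z t₀)
    have e1 : ⟪n t₀, u₀ - z t₀⟫ = -(r * p t₀) := by
      simp only [hr, hp]; rw [mul_neg, neg_neg, div_mul_cancel₀ _ hv.ne]
    have e2 : cross (n t₀) (u₀ - z t₀) = -(r * q t₀) := by
      unfold mirror at h0
      simp only [hr, hq]
      rw [div_mul_eq_mul_div, ← neg_div, eq_div_iff hv.ne]
      linarith
    rw [e1, e2] at e
    simp only [hU]
    rw [← e, add_sub_cancel]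
  obtain ⟨κ, hκ, M, hM, hest⟩ := mirror_dist_estimates hr0 (half_pos hp0)
    (by positivity : 0 < p t₀ + |q t₀| + 1)
  have ev : ∀ᶠ t in 𝓝 t₀, (t ∈ Ioo (-δ) δ ∧ dist t t₀ < ε) ∧ (p t₀ / 2 < p t ∧
      p t < p t₀ + |q t₀| + 1) ∧ |q t| < p t₀ + |q t₀| + 1 ∧ dist (U t) u₀ < ε ∧
      dist (z t) (z t₀) < κ / 2 ∧ dist (n t) (n t₀) < κ / 2 := by
    have h1 : ∀ᶠ t in 𝓝 t₀, t ∈ Ioo (-δ) δ := isOpen_Ioo.mem_nhds ht₀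
    have h2 : ∀ᶠ t in 𝓝 t₀, dist t t₀ < ε := ball_mem_nhds t₀ hε
    have h3 : ∀ᶠ t in 𝓝 t₀, p t₀ / 2 < p t :=
      hpc.continuousAt.eventually (lt_mem_nhds (by linarith))
    have h4 : ∀ᶠ t in 𝓝 t₀, p t < p t₀ + |q t₀| + 1 :=
      hpc.continuousAt.eventually (gt_mem_nhds (by linarith [abs_nonneg (q t₀)]))
    have h5 : ∀ᶠ t in 𝓝 t₀, |q t| < p t₀ + |q t₀| + 1 :=
      hqc.abs.continuousAt.eventually (gt_mem_nhds (by linarith))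
    have h6 : ∀ᶠ t in 𝓝 t₀, dist (U t) u₀ < ε := by
      have := hUc.tendsto t₀
      rw [hUt] at this
      exact this.eventually (ball_mem_nhds _ hε)
    have h7 : ∀ᶠ t in 𝓝 t₀, dist (z t) (z t₀) < κ / 2 :=
      (hzc.tendsto t₀).eventually (ball_mem_nhds _ (half_pos hκ))
    have h8 : ∀ᶠ t in 𝓝 t₀, dist (n t) (n t₀) < κ / 2 :=
      (hnc.tendsto t₀).eventually (ball_mem_nhds _ (half_pos hκ))
    filter_upwards [h1, h2, h3, h4, h5, h6, h7, h8] with t h1 h2 h3 h4 h5 h6 h7 h8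
    exact ⟨⟨h1, h2⟩, ⟨h3, h4⟩, h5, h6, h7, h8⟩
  obtain ⟨η, hη, hball⟩ := Metric.eventually_nhds_iff.1 ev
  obtain ⟨η', hη', hsurj⟩ := hch.surj t₀ η hη
  have main : ∀ s t, dist s t₀ < η → dist t t₀ < η → s < t →
      (mirror (U s) v (z t) (n t) ≤ 0 → dist (z s) (z t) ≤ M * dist (n s) (n t)) ∧
      (0 ≤ mirror (U s) v (z t) (n t) → dist (n s) (n t) ≤ M * dist (z s) (z t)) := by
    intro s t hs ht hst
    obtain ⟨⟨hsδ, -⟩, ⟨hps, hps'⟩, hqs, -, hzs, hns⟩ := hball hs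
    obtain ⟨⟨htδ, -⟩, -, -, -, hzt, hnt⟩ := hball ht
    obtain ⟨hA, hB, -⟩ := hch.mono s hsδ t htδ hst
    refine hest (hch.normal s) (hch.normal t) hA hB (hch.half_le_inner s hsδ t htδ) hps.le hps'.le
      hqs.le ?_ ?_ ?_
    · linarith [dist_triangle_right (z s) (z t) (z t₀)]
    · linarith [dist_triangle_right (n s) (n t) (n t₀)]
    · simp only [hU]; abel
  suffices h : ∃ s t, dist s t₀ < η ∧ dist t t₀ < η ∧ s < t ∧
      0 < τ * mirror (U s) v (z t) (n t) by
    obtain ⟨s, t, hs, ht, hst, hpos⟩ := h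
    obtain ⟨⟨-, hs1⟩, ⟨hps, -⟩, -, hUs, -, -⟩ := hball hs
    obtain ⟨⟨-, ht1⟩, -⟩ := hball ht
    have hv1 : ⟪n s, v - z s⟫ < 0 := by
      have : 0 < p s := by linarith
      simp only [hp] at this
      linarith
    have hn1 := (hch.normal s).norm_eq
    have hm0 : mirror (U s) v (z s) (n s) = 0 := by
      have hu' : U s - z s = (-(r * p s)) • n s + (-(r * q s)) • rot (n s) := by
        simp only [hU]; abel
      have e1 := inner_frame hn1 1 0 (-(r * p s)) (-(r * q s))
      have e2 := cross_frame hn1 1 0 (-(r * p s)) (-(r * q s))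
      simp only [one_smul, zero_smul, add_zero] at e1 e2
      unfold mirror
      rw [hu', e1, e2]
      simp only [hp, hq]
      ring
    obtain ⟨u, hu1, hu2, hu3⟩ := exists_perturbation hn1 hτ hv1 hm0 hpos hUs
    exact ⟨u, hu1, s, t, hs1, ht1, hst, hu2, hu3⟩
  have pair : ∀ f g : Plane × Plane → Plane, (∃ a b : Plane × Plane, IsUnitNormal K a.1 a.2 ∧
      IsUnitNormal K b.1 b.2 ∧ dist a (z t₀, n t₀) < η' ∧ dist b (z t₀, n t₀) < η' ∧
      M * dist (f a) (f b) < dist (g a) (g b)) → ∃ s t, dist s t₀ < η ∧ dist t t₀ < η ∧ s < t ∧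
      M * dist (f (z s, n s)) (f (z t, n t)) < dist (g (z s, n s)) (g (z t, n t)) := by
    rintro f g ⟨a, b, ha, hb, ha', hb', hab⟩
    obtain ⟨s, hs, hs1, hs2⟩ := hsurj a ha ha'
    obtain ⟨t, ht, ht1, ht2⟩ := hsurj b hb hb'
    have ea : a = (z s, n s) := Prod.ext hs1.symm hs2.symm
    have eb : b = (z t, n t) := Prod.ext ht1.symm ht2.symm
    rw [ea, eb] at hab
    rcases lt_trichotomy s t with hst | rfl | hst
    · exact ⟨s, t, hs, ht, hst, hab⟩
    · simp at hab
    · exact ⟨t, s, ht, hs, hst, by rwa [dist_comm (f _), dist_comm (g _)]⟩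
  rcases lt_or_gt_of_ne hτ with hτ | hτ
  · obtain ⟨s, t, hs, ht, hst, hlt⟩ := pair Prod.fst Prod.snd
      (hK.corner _ _ (hch.normal t₀) η' hη' M)
    refine ⟨s, t, hs, ht, hst, mul_pos_of_neg_of_neg hτ ?_⟩
    by_contra! hge
    exact (hlt.trans_le ((main s t hs ht hst).2 hge)).false
  · obtain ⟨s, t, hs, ht, hst, hlt⟩ := pair Prod.snd Prod.fst
      (hK.flat _ _ (hch.normal t₀) η' hη' M)
    refine ⟨s, t, hs, ht, hst, mul_pos hτ ?_⟩
    by_contra! hle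
    exact (hlt.trans_le ((main s t hs ht hst).1 hle)).false

/-! ### Continuum many images -/

lemma IsChart.mono_radius {K : Set Plane} {z n : ℝ → Plane} {δ δ' : ℝ} (h : IsChart K z n δ)
    (hδ' : 0 < δ') (hle : δ' ≤ δ) : IsChart K z n δ' := by
  have hsub : Ioo (-δ') δ' ⊆ Ioo (-δ) δ := Ioo_subset_Ioo (by linarith) hle
  exact ⟨hδ', h.continuous_z, h.continuous_n, h.normal,
    fun s hs t ht => h.half_le_inner s (hsub hs) t (hsub ht),
    fun s hs t ht => h.mono s (hsub hs) t (hsub ht), h.surj⟩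

lemma IsChart.injOn {K : Set Plane} {z n : ℝ → Plane} {δ : ℝ} (h : IsChart K z n δ)
    (hK : IsTypical K) : InjOn z (Ioo (-δ) δ) := by
  have key : ∀ s ∈ Ioo (-δ) δ, ∀ t ∈ Ioo (-δ) δ, s < t → z s ≠ z t := by
    intro s hs t ht hst he
    have hn : n s = n t := hK.smooth _ _ _ (h.normal s) (he ▸ h.normal t)
    have := (h.mono s hs t ht hst).2.2
    rw [he, ← hn, cross_self, sub_self] at this
    simp [cross] at this
  intro s hs t ht he
  by_contra hne
  rcases lt_or_gt_of_ne hne with hst | hst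
  · exact key s hs t ht hst he
  · exact key t ht s hs hst he.symm

/-- A chart centred at a normal which reflects `u₀` to `v`. -/
lemma exists_chart_of_points {K : Set Plane} (hK : IsCompact K) (hKc : Convex ℝ K)
    (hKi : (interior K).Nonempty) (u₀ v : Plane) :
    ∃ z n : ℝ → Plane, ∃ δ, ∃ r > 0, IsChart K z n δ ∧ mirror u₀ v (z 0) (n 0) = 0 ∧
      ∀ u ∈ ball u₀ r, ∀ t ∈ Ioo (-δ) δ, ⟪n t, u - z t⟫ < 0 ∧ ⟪n t, v - z t⟫ < 0 := by
  obtain ⟨z₀, n₀, hn, hu, hv, h0⟩ := exists_mirror_eq_zero hK hKi u₀ v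
  obtain ⟨z, n, δ, hch, rfl, rfl⟩ := hn.exists_chart hK hKc
  have hzc := hch.continuous_z
  have hnc := hch.continuous_n
  have e1 : ∀ᶠ x : Plane × ℝ in 𝓝 (u₀, 0), ⟪n x.2, x.1 - z x.2⟫ < 0 := by
    have : Continuous fun x : Plane × ℝ => ⟪n x.2, x.1 - z x.2⟫ := by fun_prop
    exact (this.tendsto (u₀, 0)).eventually_lt_const hu
  have e2 : ∀ᶠ x : Plane × ℝ in 𝓝 (u₀, 0), ⟪n x.2, v - z x.2⟫ < 0 := by
    have : Continuous fun x : Plane × ℝ => ⟪n x.2, v - z x.2⟫ := by fun_prop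
    exact (this.tendsto (u₀, 0)).eventually_lt_const hv
  obtain ⟨r, hr, hball⟩ := Metric.eventually_nhds_iff.1 (e1.and e2)
  refine ⟨z, n, min δ r, r, hr, hch.mono_radius (lt_min hch.pos hr) (min_le_left _ _), h0, ?_⟩
  intro u hu t ht
  have hd : dist (u, t) (u₀, (0 : ℝ)) < r := by
    have h1 : |t| < r := (abs_lt.2 ht).trans_le (min_le_right _ _)
    rw [Prod.dist_eq, max_lt_iff, Real.dist_0_eq_abs]
    exact ⟨hu, h1⟩
  have h := hball hd
  exact h

/-- The points `u` for which `τ * mirror` changes sign from minus to plus between `a` and `b`. -/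
def signChangeSet (v : Plane) (z n : ℝ → Plane) (τ a b : ℝ) : Set Plane :=
  {u | ∃ x y, x ∈ Ioo a b ∧ y ∈ Ioo a b ∧ x < y ∧ τ * mirror u v (z x) (n x) < 0 ∧
    0 < τ * mirror u v (z y) (n y)}

lemma isOpen_signChangeSet (v : Plane) (z n : ℝ → Plane) (τ a b : ℝ) :
    IsOpen (signChangeSet v z n τ a b) := by
  have : signChangeSet v z n τ a b = ⋃ (x : ℝ) (y : ℝ) (_ : x ∈ Ioo a b ∧ y ∈ Ioo a b ∧ x < y),
      {u | τ * mirror u v (z x) (n x) < 0} ∩ {u | 0 < τ * mirror u v (z y) (n y)} := by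
    ext u
    simp only [signChangeSet, mem_ofPred_eq, mem_iUnion, mem_inter_iff, exists_prop, and_assoc]
  rw [this]
  exact isOpen_iUnion fun x => isOpen_iUnion fun y => isOpen_iUnion fun _ =>
    (isOpen_lt (by fun_prop) continuous_const).inter (isOpen_lt continuous_const (by fun_prop))

lemma IsChart.mem_closure_signChangeSet {K : Set Plane} {z n : ℝ → Plane} {δ : ℝ}
    (hK : IsTypical K) (hch : IsChart K z n δ) {u₀ v : Plane} {t₀ a b : ℝ}
    (ht₀ : t₀ ∈ Ioo (-δ) δ) (hab : t₀ ∈ Ioo a b) (hu : ⟪n t₀, u₀ - z t₀⟫ < 0)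
    (hv : ⟪n t₀, v - z t₀⟫ < 0) (h0 : mirror u₀ v (z t₀) (n t₀) = 0) {τ : ℝ} (hτ : τ ≠ 0) :
    u₀ ∈ closure (signChangeSet v z n τ a b) := by
  rw [Metric.mem_closure_iff]
  intro ε hε
  obtain ⟨η, hη, hηab⟩ := Metric.isOpen_iff.1 isOpen_Ioo t₀ hab
  obtain ⟨u, hud, x, y, hx, hy, hxy, h1, h2⟩ :=
    hch.exists_sign_changes hK ht₀ hu hv h0 (lt_min hε hη) hτ
  refine ⟨u, ⟨x, y, hηab (hx.trans_le (min_le_right _ _)), hηab (hy.trans_le (min_le_right _ _)),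
    hxy, h1, h2⟩, ?_⟩
  rw [dist_comm]
  exact hud.trans_le (min_le_left _ _)

lemma exists_zero_of_mul_neg {f : ℝ → ℝ} (hf : Continuous f) {x y : ℝ} (hx : f x < 0)
    (hy : 0 < f y) : ∃ c, f c = 0 ∧ min x y ≤ c ∧ c ≤ max x y ∧ c ≠ x ∧ c ≠ y := by
  obtain ⟨c, hc, hc0⟩ := intermediate_value_uIcc (hf.continuousOn (s := uIcc x y))
    (mem_uIcc.2 (Or.inl ⟨hx.le, hy.le⟩) : (0 : ℝ) ∈ uIcc (f x) (f y))
  refine ⟨c, hc0, hc.1, hc.2, ?_, ?_⟩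
  · rintro rfl; exact hx.ne hc0
  · rintro rfl; exact hy.ne' hc0

/-- A continuous function which changes sign in both directions on an interval has at least two
zeros there. -/
lemma exists_zero_ne {f : ℝ → ℝ} (hf : Continuous f) {a b t x y x' y' : ℝ}
    (hx : x ∈ Ioo a b) (hy : y ∈ Ioo a b) (hxy : x < y) (hfx : f x < 0) (hfy : 0 < f y)
    (hx' : x' ∈ Ioo a b) (hy' : y' ∈ Ioo a b) (hxy' : x' < y') (hfx' : 0 < f x')
    (hfy' : f y' < 0) : ∃ c ∈ Ioo a b, f c = 0 ∧ c ≠ t := by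
  obtain ⟨c, hc0, hc1, hc2, hcx, hcy⟩ := exists_zero_of_mul_neg hf hfx hfy
  obtain ⟨d, hd0, hd1, hd2, hdx, hdy⟩ := exists_zero_of_mul_neg hf hfy' hfx'
  obtain ⟨e, he0, he1, he2, -, -⟩ := exists_zero_of_mul_neg hf hfx hfx'
  rw [min_eq_left hxy.le] at hc1
  rw [max_eq_right hxy.le] at hc2
  rw [min_eq_right hxy'.le] at hd1
  rw [max_eq_left hxy'.le] at hd2
  by_cases hct : c = t
  · by_cases hdt : d = t
    · refine ⟨e, ⟨(lt_min hx.1 hx'.1).trans_le he1, he2.trans_lt (max_lt hx.2 hx'.2)⟩, he0, ?_⟩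
      have h1 : x < t := lt_of_le_of_ne (hct ▸ hc1) (hct ▸ hcx.symm)
      have h2 : x' < t := lt_of_le_of_ne (hdt ▸ hd1) (hdt ▸ hdy.symm)
      exact (he2.trans_lt (max_lt h1 h2)).ne
    · exact ⟨d, ⟨hx'.1.trans_le hd1, hd2.trans_lt hy'.2⟩, hd0, hdt⟩
  · exact ⟨c, ⟨hx.1.trans_le hc1, hc2.trans_lt hy.2⟩, hc0, hct⟩

/-- If the zero set of `mirror` has no isolated points, then `u` sees continuum many images. -/
lemma continuum_le_of_signChangeSet {C : Set Plane} {z n : ℝ → Plane} {δ : ℝ}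
    (hC : IsTypical C) (hch : IsChart C z n δ) {u v : Plane}
    (hside : ∀ t ∈ Ioo (-δ) δ, ⟪n t, u - z t⟫ < 0 ∧ ⟪n t, v - z t⟫ < 0)
    (hu : u ∈ signChangeSet v z n 1 (-(δ / 2)) (δ / 2))
    (hres : ∀ a b : ℚ, ∀ t ∈ Ioo (-δ) δ, t ∈ Ioo (a : ℝ) b → mirror u v (z t) (n t) = 0 →
      u ∈ signChangeSet v z n 1 a b ∧ u ∈ signChangeSet v z n (-1) a b) :
    𝔠 ≤ #{w : Plane // SeesImageVia C u v w} := by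
  have hδ := hch.pos
  have hzc := hch.continuous_z
  have hnc := hch.continuous_n
  set f : ℝ → ℝ := fun t => mirror u v (z t) (n t) with hf
  have hfc : Continuous f := by fun_prop
  set Z : Set ℝ := Ioo (-(δ / 2)) (δ / 2) ∩ f ⁻¹' {0} with hZ
  have hhalf : Icc (-(δ / 2)) (δ / 2) ⊆ Ioo (-δ) δ := fun t ht =>
    ⟨by linarith [ht.1], by linarith [ht.2]⟩
  have hne : Z.Nonempty := by
    obtain ⟨x, y, hx, hy, hxy, h1, h2⟩ := hu
    rw [one_mul] at h1 h2
    obtain ⟨c, hc0, hc1, hc2, -⟩ := exists_zero_of_mul_neg hfc h1 h2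
    exact ⟨c, ⟨(lt_min hx.1 hy.1).trans_le hc1, hc2.trans_lt (max_lt hx.2 hy.2)⟩, hc0⟩
  have hpre : Preperfect Z := by
    rintro t ⟨ht, ht0⟩
    rw [accPt_iff_nhds]
    intro V hV
    obtain ⟨a', b', ⟨hat, htb⟩, hsub⟩ :=
      mem_nhds_iff_exists_Ioo_subset.1 (inter_mem hV (isOpen_Ioo.mem_nhds ht))
    obtain ⟨a, ha1, ha2⟩ := exists_rat_btwn hat
    obtain ⟨b, hb1, hb2⟩ := exists_rat_btwn htb
    obtain ⟨⟨x, y, hx, hy, hxy, h1, h2⟩, x', y', hx', hy', hxy', h1', h2'⟩ :=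
      hres a b t (hhalf ⟨ht.1.le, ht.2.le⟩) ⟨ha2, hb1⟩ ht0
    obtain ⟨c, hc, hc0, hct⟩ := exists_zero_ne (t := t) hfc hx hy hxy (by simpa using h1)
      (by simpa using h2) hx' hy' hxy' (by simpa using h1') (by simpa using h2')
    have := hsub ⟨ha1.trans hc.1, hc.2.trans hb2⟩
    exact ⟨c, ⟨this.1, this.2, hc0⟩, hct⟩
  have hclosure : closure Z ⊆ Icc (-(δ / 2)) (δ / 2) ∩ f ⁻¹' {0} :=
    closure_minimal (inter_subset_inter_left _ Ioo_subset_Icc_self)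
      (isClosed_Icc.inter (isClosed_singleton.preimage hfc))
  obtain ⟨g, hg, -, hginj⟩ := hpre.perfect_closure.exists_nat_bool_injection hne.closure
  have hgZ : ∀ s, g s ∈ Ioo (-δ) δ ∧ f (g s) = 0 := fun s =>
    ⟨hhalf (hclosure (hg (mem_range_self s))).1, (hclosure (hg (mem_range_self s))).2⟩
  have hsees : ∀ s, SeesImageVia C u v (z (g s)) := fun s =>
    seesImageVia_of_mirror_eq_zero (hch.normal _)
      (fun n' hn' => hC.smooth _ _ _ (hch.normal _) hn') (hside _ (hgZ s).1).1
      (hside _ (hgZ s).1).2 (hgZ s).2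
  have hinj : Function.Injective fun s : ℕ → Bool =>
      (⟨z (g s), hsees s⟩ : {w : Plane // SeesImageVia C u v w}) := by
    intro s t hst
    exact hginj (hch.injOn hC (hgZ s).1 (hgZ t).1 (congrArg Subtype.val hst))
  have h𝔠 : #(ℕ → Bool) = 𝔠 := by simp
  rw [← h𝔠]
  exact Cardinal.mk_le_of_injective hinj

lemma mk_plane : #Plane = 𝔠 := by
  rw [Cardinal.mk_congr (WithLp.equiv 2 (Fin 2 → ℝ))]
  simp only [Cardinal.mk_pi, Cardinal.mk_real, Cardinal.prod_const, Cardinal.lift_id,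
    Cardinal.mk_fin]
  exact Cardinal.power_nat_eq Cardinal.aleph0_le_continuum (by norm_num)

lemma IsChart.frontier {K : Set Plane} (hK : IsCompact K) {z n : ℝ → Plane} {δ : ℝ}
    (h : IsChart K z n δ) : IsChart (frontier K) z n δ := by
  obtain ⟨h1, h2, h3, h4, h5, h6, h7⟩ := h
  refine ⟨h1, h2, h3, ?_, h5, h6, ?_⟩
  · simpa only [isUnitNormal_frontier_iff hK] using h4
  · simpa only [isUnitNormal_frontier_iff hK] using h7

/-- For a typical curve `C` and any point `v`, most points see continuum many images of `v`. -/
theorem eventually_continuum_images {C : ConvexCurve} (hC : IsTypical C.points) (v : Plane) :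
    ∀ᶠ u : Plane in residual Plane, #{z : Plane // SeesImageVia C.points u v z} = 𝔠 := by
  obtain ⟨K, hKc, hK, hKi, hKf⟩ := exists_body C
  choose z n δ r hr hch h0 hside using fun u₀ => exists_chart_of_points hK hKc hKi u₀ v
  replace hch : ∀ u₀, IsChart C.points (z u₀) (n u₀) (δ u₀) := fun u₀ =>
    hKf ▸ (hch u₀).frontier hK
  set Q : Plane → Set Plane := fun i =>
    ball i (r i) ∩ signChangeSet v (z i) (n i) 1 (-(δ i / 2)) (δ i / 2) with hQ
  have hQo : ∀ i, IsOpen (Q i) := fun i => isOpen_ball.inter (isOpen_signChangeSet _ _ _ _ _ _)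
  have hQd : Dense (⋃ i, Q i) := by
    intro i
    have hδ := (hch i).pos
    have h1 : i ∈ closure (signChangeSet v (z i) (n i) 1 (-(δ i / 2)) (δ i / 2)) :=
      (hch i).mem_closure_signChangeSet hC (t₀ := 0) ⟨by linarith, hδ⟩
        ⟨by linarith, by linarith⟩
        (hside i i (mem_ball_self (hr i)) 0 ⟨by linarith, hδ⟩).1
        (hside i i (mem_ball_self (hr i)) 0 ⟨by linarith, hδ⟩).2 (h0 i) one_ne_zero
    have h2 : i ∈ closure (Q i) := by
      refine isOpen_ball.inter_closure ⟨mem_ball_self (hr i), h1⟩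
    exact closure_mono (subset_iUnion Q i) h2
  obtain ⟨T, hT, hTQ⟩ := TopologicalSpace.isOpen_iUnion_countable Q hQo
  have hcov : ∀ᶠ u in residual Plane, u ∈ ⋃ i, Q i :=
    residual_of_dense_open (isOpen_iUnion hQo) hQd
  have hsign : ∀ τ : ℝ, ∀ᶠ u in residual Plane, ∀ i ∈ T, ∀ a b : ℚ,
      u ∈ closure (signChangeSet v (z i) (n i) τ a b) → u ∈ signChangeSet v (z i) (n i) τ a b := by
    intro τ
    rw [eventually_countable_ball hT]
    intro i _
    rw [eventually_countable_forall]
    intro a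
    rw [eventually_countable_forall]
    intro b
    exact eventually_residual_mem_of_mem_closure (isOpen_signChangeSet _ _ _ _ _ _)
  filter_upwards [hcov, hsign 1, hsign (-1)] with u hu h1 h2
  rw [← hTQ, mem_iUnion₂] at hu
  obtain ⟨i, hiT, hui, hus⟩ := hu
  refine le_antisymm (mk_plane ▸ Cardinal.mk_subtype_le _) ?_
  refine continuum_le_of_signChangeSet hC (hch i) (hside i u hui) hus fun a b t ht hab ht0 => ?_
  obtain ⟨hut, hvt⟩ := hside i u hui t ht
  exact ⟨h1 i hiT a b ((hch i).mem_closure_signChangeSet hC ht hab hut hvt ht0 one_ne_zero),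
    h2 i hiT a b ((hch i).mem_closure_signChangeSet hC ht hab hut hvt ht0 (by norm_num))⟩

end ConvexMirror

theorem theorem1p2 :
    ∀ᶠ C : ConvexCurve in residual ConvexCurve,
      ∀ v : Plane, v ∉ C.points →
        ∀ᶠ u : Plane in residual Plane,
          #{z : Plane // SeesImageVia C.points u v z} = 𝔠 := by
  filter_upwards [ConvexMirror.eventually_isTypical] with C hC v _
  exact ConvexMirror.eventually_continuum_images hC v
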